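/- **Problem.** For an array $A=(A_0,\dots,A_{N-1})$ of nonnegative integers and integers $1\le l\le K\le N$, the problem $\ell$-SMIN asks, for every $i\in\{0,\dots,N-K\}$, for the $l$-th smallest element of the window $(A_i,\dots,A_{i+K-1})$, i.e. the element of rank $l$ when the window is sorted with ties broken by index. **Model.** A multi-pass streaming algorithm knows the parameters $l,N,K$ and an upper bound $R$ on the values $A_j$ beforehand, and reads $A_0,\dots,A_{N-1}$ in order once in each input pass. Its memory is a bit string; on reading an element it computes, from the parameters, the current memory and this element, its new memory and a finite list of entries (position, value) that it writes to a write-only output stream with positions $0,\dots,N-K$. The rule is computable and the same for all values of the parameters. Every output position must be written exactly once. The algorithm uses at most $r$ output passes if the chronological sequence of written entries is a concatenation of at most $r$ segments in each of which the positions strictly increase. The space used is the maximal length of the memory, taken before the first element is read and after each element is read. **Theorem.** There are a deterministic multi-pass streaming algorithm and a constant $C$ such that for all integers $1\le l\le K\le N$ and $R\ge 1$ with $NR\ge 2$, and all arrays $A$ of length $N$ with entries in $\{0,\dots,R\}$, the algorithm with parameters $(l,N,K,R)$ solves $\ell$-SMIN on $A$ (it writes at every position $i\in\{0,\dots,N-K\}$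 exactly once, and the value written there is the $l$-th smallest element of $(A_i,\dots,A_{i+K-1})$) in $l+1$ input passes, with at most $l$ output passes, and in space at most $$C\, l^{3/2} N^{1/2}(\log N+\log R)$$ bits. In particular, $C$ does not depend on $l,N,K,R$ or $A$. -/

import Mathlib

/-- A deterministic multi-pass streaming algorithm with parameters in `P` (the data it knows
beforehand). Its memory is a bit string. When the next element of the input stream is read, it
updates its memory and writes finitely many entries to the output stream; an entry `(i, v)` is the
value `v` written at position `i`. The current position in the input and the number of the current
pass are not supplied: an algorithm that uses them has to keep them in memory. One uniform,
computable rule serves all parameters. -/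
structure StreamAlg (P : Type) [Primcodable P] where
  /-- the memory before the first element is read -/
  init : P → List Bool
  /-- new memory and written entries, from the old memory and the element being read -/
  step : P → List Bool → ℕ → List Bool × List (ℕ × ℕ)
  init_computable : Computable init
  step_computable : Computable fun x : P × List Bool × ℕ => step x.1 x.2.1 x.2.2

namespace StreamAlg

variable {P : Type} [Primcodable P]

/-- The memory after reading the elements of `xs` in order, starting from memory `m`. -/
def memoryFrom (alg : StreamAlg P) (p : P) : List Bool → List ℕ → List Bool
  | m, [] => m
  | m, x :: xs => memoryFrom alg p (alg.step p m x).1 xs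

/-- The entries written, in chronological order, while reading the elements of `xs` in order,
starting from memory `m`. -/
def outputFrom (alg : StreamAlg P) (p : P) : List Bool → List ℕ → List (ℕ × ℕ)
  | _, [] => []
  | m, x :: xs => (alg.step p m x).2 ++ outputFrom alg p (alg.step p m x).1 xs

/-- What the algorithm reads during `q` passes over the input array `A`. -/
def passes {N : ℕ} (q : ℕ) (A : Fin N → ℕ) : List ℕ :=
  (List.replicate q (List.ofFn A)).flatten

/-- All entries written during `q` passes over `A`, in chronological order. -/
def output (alg : StreamAlg P) (p : P) {N : ℕ} (q : ℕ) (A : Fin N → ℕ) : List (ℕ × ℕ) :=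
  alg.outputFrom p (alg.init p) (passes q A)

/-- At every moment of its `q` passes over `A`, the algorithm holds at most `S` bits of memory. -/
def SpaceAtMost (alg : StreamAlg P) (p : P) {N : ℕ} (q : ℕ) (A : Fin N → ℕ) (S : ℝ) : Prop :=
  ∀ xs : List ℕ, xs <+: passes q A → ((alg.memoryFrom p (alg.init p) xs).length : ℝ) ≤ S

end StreamAlg

/-- The chronological list `out` of written entries can be produced in at most `r` linear scans
through the output stream: it is a concatenation of at most `r` segments in each of which the
positions strictly increase. -/
def OutputPassesAtMost (out : List (ℕ × ℕ)) (r : ℕ) : Prop :=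
  ∃ scans : List (List (ℕ × ℕ)), scans.length ≤ r ∧ scans.flatten = out ∧
    ∀ s ∈ scans, (s.map Prod.fst).Pairwise (· < ·)

/-- The rank of `A j` in the window `[i, i + K)` of `A`: its position, counted from `1`, when the
window is sorted with ties broken by index. -/
def windowRank {N : ℕ} (A : Fin N → ℕ) (K i : ℕ) (j : Fin N) : ℕ :=
  (Finset.univ.filter fun j' : Fin N =>
    i ≤ (j' : ℕ) ∧ (j' : ℕ) < i + K ∧ (A j' < A j ∨ (A j' = A j ∧ j' ≤ j))).card

/-- `v` is the `l`-th smallest element of the window `[i, i + K)` of `A`. -/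
def IsLthSmallest {N : ℕ} (A : Fin N → ℕ) (K l i v : ℕ) : Prop :=
  ∃ j : Fin N, i ≤ (j : ℕ) ∧ (j : ℕ) < i + K ∧ windowRank A K i j = l ∧ A j = v

/-- The written entries solve the sliding window problem: each of the positions `0, …, N - K` is
written exactly once (and no other position is written), and the value written at position `i` is
the `l`-th smallest element of the window `[i, i + K)`. -/
def SolvesLSmin {N : ℕ} (A : Fin N → ℕ) (K l : ℕ) (out : List (ℕ × ℕ)) : Prop :=
  (out.map Prod.fst).Perm (List.range (N - K + 1)) ∧
    ∀ e ∈ out, IsLthSmallest A K l e.1 e.2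

/-! Cut the positions into blocks of length `B = blockLength N`, about √N. All windows that start in
block `b` share a middle part; beyond it, such a window contains only an end piece of block `b` and
a start piece of the tail `[b * B + K, (b + 1) * B + K)`. The boundaries `b * B` and `b * B + K` cut
the array into at most `2 * B` cells. The `l` first entries of every cell (`summary`), collected in
pass 0, determine what matters about the middle parts. They also decide for each block whether its
tail (`IsLate`) or the block itself (`HasHead`) can contribute to the `l` first entries of a window
(`isLate_iff`, `hasHead_iff`). These flags are recomputed from memory at every step, never stored.

A late window is answered in pass 1 when its last element arrives. Its tail is then recent, but
entries of its block must have been held for up to `K` steps. This is needed only for blocks that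
are both late and have heads, and at most `l + 2` of them are held at any time (`card_crossing_le`,
`card_held_blocks_le`). Indeed, among such blocks within reach of each other, consider the block
with the last witness in the order: every other block places a witness of its own before it in the
middle part, and there is room for fewer than `l`.

A window that is not late could be answered soon after its block, but the output order may force it
behind an earlier late window. Without a head it can wait, since the summary suffices at any time.
With a head it is put off to pass 2, where every answer has the same delay and the order is
automatic. `mem_summary_or_held` checks that each answer finds all the entries it needs. For `l = 1`
nothing is put off (`not_isSecond_of_one`), so two input passes and one output pass suffice; for `l
≥ 2` three and two do, and further passes write nothing.

The memory holds O(`l * B`) entries of O(log N + log R) bits (`card_known_le`), so a factor `l`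
appears where `l ^ (3 / 2)` is allowed. -/

open Finset

namespace SlidingRank

/-! ### Ranks in finite sets of entries. -/

/-- The order of entries `(position, value)` by value, with ties broken by position. -/
def precedes (f e : ℕ × ℕ) : Prop := f.2 < e.2 ∨ (f.2 = e.2 ∧ f.1 < e.1)

instance : DecidableRel precedes := fun _ _ => inferInstanceAs (Decidable (_ ∨ _))

/-- The key that realizes `precedes` as a linear order. -/
def key (e : ℕ × ℕ) : ℕ ×ₗ ℕ := toLex (e.2, e.1)

theorem precedes_iff {f e : ℕ × ℕ} : precedes f e ↔ key f < key e := by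
  simp [precedes, key, Prod.Lex.toLex_lt_toLex]

theorem key_injective : Function.Injective key := by
  rintro ⟨a, b⟩ ⟨c, d⟩ h
  have h' : ((b, a) : ℕ × ℕ) = (d, c) := toLex.injective h
  simp only [Prod.mk.injEq] at h' ⊢
  exact ⟨h'.2, h'.1⟩

theorem precedes_or_precedes {f e : ℕ × ℕ} (h : f ≠ e) : precedes f e ∨ precedes e f := by
  rw [precedes_iff, precedes_iff]
  exact lt_or_gt_of_ne (key_injective.ne h)

theorem precedes_trans {f g e : ℕ × ℕ} (h₁ : precedes f g) (h₂ : precedes g e) :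
    precedes f e := by
  rw [precedes_iff] at *
  exact h₁.trans h₂

theorem not_precedes_self (e : ℕ × ℕ) : ¬ precedes e e := by
  simp [precedes_iff]

/-- The number of entries of `S` that precede `e`. -/
def rank (S : Finset (ℕ × ℕ)) (e : ℕ × ℕ) : ℕ := #{f ∈ S | precedes f e}

theorem rank_mono {S T : Finset (ℕ × ℕ)} (h : S ⊆ T) (e : ℕ × ℕ) : rank S e ≤ rank T e :=
  card_le_card (filter_subset_filter _ h)

theorem rank_le_of_precedes {S : Finset (ℕ × ℕ)} {f e : ℕ × ℕ} (h : precedes f e) :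
    rank S f ≤ rank S e :=
  card_le_card (monotone_filter_right _ fun _ _ hg => precedes_trans hg h)

/-- Induction that adds the last entry: it changes no other rank, and its own rank is the size of
the rest. -/
theorem card_rank_lt (S : Finset (ℕ × ℕ)) (n : ℕ) : #{f ∈ S | rank S f < n} = min n #S := by
  induction S using Finset.induction_on_max_value key with
  | empty => simp
  | insert a S ha hmax ih =>
    have h₁ : rank (insert a S) a = #S := by
      unfold rank
      rw [filter_insert, if_neg (not_precedes_self a), filter_true_of_mem]
      intro x hx
      rw [precedes_iff]
      exact lt_of_le_of_ne (hmax x hx) (key_injective.ne (by rintro rfl; exact ha hx))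
    have h₂ : ∀ f ∈ S, rank (insert a S) f = rank S f := by
      intro f hf
      unfold rank
      rw [filter_insert, if_neg]
      rw [precedes_iff]
      exact not_lt.2 (hmax f hf)
    have h₃ : {f ∈ S | rank (insert a S) f < n} = {f ∈ S | rank S f < n} :=
      filter_congr fun f hf => by rw [h₂ f hf]
    rw [filter_insert, h₁, h₃, card_insert_of_notMem ha]
    split_ifs with h
    · rw [card_insert_of_notMem (by simp [ha]), ih]
      omega
    · rw [ih]
      omega

theorem rank_eq_of_rank_lt {S T : Finset (ℕ × ℕ)} {l : ℕ} {e : ℕ × ℕ} (hTS : T ⊆ S)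
    (h : {f ∈ S | rank S f < l} ⊆ T) (he : rank S e < l) : rank T e = rank S e := by
  refine le_antisymm (rank_mono hTS e) (card_le_card fun f hf => ?_)
  rw [mem_filter] at hf ⊢
  exact ⟨h (mem_filter.2 ⟨hf.1, (rank_le_of_precedes hf.2).trans_lt he⟩), hf.2⟩

/-- Here `e` need not lie in `S`. If at least `l` entries of `S` precede `e`, the first `l` of these
have rank below `l` in all of `S`, so they survive in `T`. -/
theorem rank_lt_iff {S T : Finset (ℕ × ℕ)} {l : ℕ} (hTS : T ⊆ S)
    (h : {f ∈ S | rank S f < l} ⊆ T) (e : ℕ × ℕ) : rank T e < l ↔ rank S e < l := by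
  refine ⟨fun hT => ?_, fun hS => (rank_mono hTS e).trans_lt hS⟩
  by_contra hS
  rw [not_lt] at hS
  set S' := {f ∈ S | precedes f e} with hS'
  have hcard := card_rank_lt S' l
  rw [min_eq_left (show l ≤ #S' from hS)] at hcard
  have hsub : {f ∈ S' | rank S' f < l} ⊆ {f ∈ T | precedes f e} := by
    intro f hf
    rw [hS', mem_filter, mem_filter] at hf
    rw [mem_filter]
    refine ⟨h (mem_filter.2 ⟨hf.1.1, ?_⟩), hf.1.2⟩
    refine lt_of_le_of_lt (card_le_card fun g hg => ?_) hf.2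
    rw [mem_filter] at hg
    exact mem_filter.2 ⟨mem_filter.2 ⟨hg.1, precedes_trans hg.2 hf.1.2⟩, hg.2⟩
  have := card_le_card hsub
  have hT' : #{f ∈ T | precedes f e} < l := hT
  omega

theorem exists_rank_add_one_eq {S : Finset (ℕ × ℕ)} {l : ℕ} (hl : 1 ≤ l) (hS : l ≤ #S) :
    ∃ e ∈ S, rank S e + 1 = l := by
  have h₁ := card_rank_lt S l
  have h₂ := card_rank_lt S (l - 1)
  by_contra! hne
  have : {f ∈ S | rank S f < l} = {f ∈ S | rank S f < l - 1} := by
    refine filter_congr fun f hf => ?_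
    have := hne f hf
    omega
  rw [this, h₂] at h₁
  omega

/-! ### Blocks, middle parts, and the count of blocks that are late and have heads. -/

/-- The entries of `S` with position in `[lo, hi)`. -/
def seg (S : Finset (ℕ × ℕ)) (lo hi : ℕ) : Finset (ℕ × ℕ) := {f ∈ S | lo ≤ f.1 ∧ f.1 < hi}

theorem mem_seg {S : Finset (ℕ × ℕ)} {lo hi : ℕ} {f : ℕ × ℕ} :
    f ∈ seg S lo hi ↔ f ∈ S ∧ lo ≤ f.1 ∧ f.1 < hi := mem_filter

theorem seg_subset_seg {S : Finset (ℕ × ℕ)} {lo hi lo' hi' : ℕ} (h₁ : lo' ≤ lo)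
    (h₂ : hi ≤ hi') : seg S lo hi ⊆ seg S lo' hi' := by
  intro f hf
  rw [mem_seg] at *
  exact ⟨hf.1, h₁.trans hf.2.1, hf.2.2.trans_le h₂⟩

/-- For a window that starts in block `b` (blocks have length `B`), `seg S ((b + 1) * B) (b * B + K)`
is its middle part, common to all such windows. Some entry behind the middle part is
preceded by fewer than `l` entries of the middle part. -/
def IsLate (B K l : ℕ) (S : Finset (ℕ × ℕ)) (b : ℕ) : Prop :=
  ∃ e ∈ S, b * B + K ≤ e.1 ∧ e.1 < (b + 1) * B + K ∧
    rank (seg S ((b + 1) * B) (b * B + K)) e < l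

/-- Some entry of block `b` is preceded by fewer than `l` entries of the middle part. -/
def HasHead (B K l : ℕ) (S : Finset (ℕ × ℕ)) (b : ℕ) : Prop :=
  ∃ e ∈ S, b * B ≤ e.1 ∧ e.1 < (b + 1) * B ∧
    rank (seg S ((b + 1) * B) (b * B + K)) e < l

/-- At most `l` blocks within reach of each other can be both late and have heads. -/
theorem card_crossing_le {B K l c : ℕ} {U : Finset (ℕ × ℕ)} {S : Finset ℕ}
    (hS : ∀ b ∈ S, IsLate B K l U b ∧ HasHead B K l U b)
    (hc : ∀ b ∈ S, c ≤ b ∧ (b + 1) * B ≤ c * B + K) : #S ≤ l := by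
  rcases S.eq_empty_or_nonempty with rfl | hne
  · simp
  have hy : ∀ b, ∃ y, b ∈ S → y ∈ U ∧ b * B + K ≤ y.1 ∧ y.1 < (b + 1) * B + K ∧
      rank (seg U ((b + 1) * B) (b * B + K)) y < l := fun b => by
    by_cases hb : b ∈ S
    · obtain ⟨y, hy⟩ := (hS b hb).1
      exact ⟨y, fun _ => hy⟩
    · exact ⟨0, fun h => absurd h hb⟩
  have hx : ∀ b, ∃ x, b ∈ S → x ∈ U ∧ b * B ≤ x.1 ∧ x.1 < (b + 1) * B ∧
      rank (seg U ((b + 1) * B) (b * B + K)) x < l := fun b => by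
    by_cases hb : b ∈ S
    · obtain ⟨y, hy⟩ := (hS b hb).2
      exact ⟨y, fun _ => hy⟩
    · exact ⟨0, fun h => absurd h hb⟩
  choose y hy using hy
  choose x hx using hx
  -- The last of all witnesses is `z`, belonging to block `m`. It lies outside the middle part of
  -- `m`, where fewer than `l` entries precede it.
  obtain ⟨m, hm, hmax⟩ := S.exists_max_image (fun b => max (key (x b)) (key (y b))) hne
  obtain ⟨z, hz, hzr, hzm⟩ : ∃ z, max (key (x m)) (key (y m)) = key z ∧
      rank (seg U ((m + 1) * B) (m * B + K)) z < l ∧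
      ¬ ((m + 1) * B ≤ z.1 ∧ z.1 < m * B + K) := by
    have h₁ := hx m hm
    have h₂ := hy m hm
    rcases max_choice (key (x m)) (key (y m)) with h | h
    · exact ⟨x m, h, h₁.2.2.2, by omega⟩
    · exact ⟨y m, h, h₂.2.2.2, by omega⟩
  -- A block after `m` lies in the middle part of `m`, and so does the tail of a block before `m`.
  -- Hence every other block contributes an entry there, and it precedes `z`.
  let g : ℕ → ℕ × ℕ := fun b => if m < b then x b else y b
  have hcm := hc m hm
  have hcmB := Nat.mul_le_mul_right B hcm.1
  have hgm : ∀ b ∈ S.erase m, g b ∈ {f ∈ seg U ((m + 1) * B) (m * B + K) | precedes f z} := by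
    intro b hb
    rw [mem_erase] at hb
    have hb' := hc b hb.2
    have h₁ := hx b hb.2
    have h₂ := hy b hb.2
    have hgz : key (g b) ≤ key z := by
      rw [← hz]
      refine le_trans ?_ (hmax b hb.2)
      simp only [g]
      split_ifs
      · exact le_max_left _ _
      · exact le_max_right _ _
    have hseg : g b ∈ U ∧ (m + 1) * B ≤ (g b).1 ∧ (g b).1 < m * B + K := by
      simp only [g]
      split_ifs with hlt
      · have := Nat.mul_le_mul_right B (show m + 1 ≤ b from hlt)
        exact ⟨h₁.1, by omega, by omega⟩
      · have := Nat.mul_le_mul_right B (show b + 1 ≤ m by omega)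
        have := Nat.mul_le_mul_right B hb'.1
        exact ⟨h₂.1, by omega, by omega⟩
    refine mem_filter.2 ⟨mem_seg.2 hseg, precedes_iff.2 (lt_of_le_of_ne hgz
      (key_injective.ne ?_))⟩
    intro h
    rw [h] at hseg
    exact hzm hseg.2
  have hinj : Set.InjOn g (S.erase m : Finset ℕ) := by
    intro b hb b' hb' h
    have hbS := (mem_erase.1 hb).2
    have hbS' := (mem_erase.1 hb').2
    have h₁ := hx b hbS
    have h₂ := hy b hbS
    have h₁' := hx b' hbS'
    have h₂' := hy b' hbS'
    have hcb := hc b hbS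
    have hcb' := hc b' hbS'
    have k₁ := Nat.mul_le_mul_right B hcb.1
    have k₂ := Nat.mul_le_mul_right B hcb'.1
    have hpos : (g b).1 = (g b').1 := by rw [h]
    have key₁ : b < b' → (b + 1) * B ≤ b' * B := fun h => Nat.mul_le_mul_right B h
    have key₂ : b' < b → (b' + 1) * B ≤ b * B := fun h => Nat.mul_le_mul_right B h
    rcases lt_trichotomy b b' with hlt | heq | hlt
    · have := key₁ hlt
      simp only [g] at hpos
      split_ifs at hpos <;> omega
    · exact heq
    · have := key₂ hlt
      simp only [g] at hpos
      split_ifs at hpos <;> omega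
  have hcard := card_le_card_of_injOn g hgm hinj
  rw [card_erase_of_mem hm] at hcard
  have : #{f ∈ seg U ((m + 1) * B) (m * B + K) | precedes f z} < l := hzr
  omega

/-- For `l = 1` the two witnesses would lie in each other's middle parts, and each would have to be
first. -/
theorem not_hasHead_of_isLate {B K b₀ b : ℕ} {U : Finset (ℕ × ℕ)} (hlt : b₀ < b)
    (hb : (b + 1) * B ≤ b₀ * B + K) (hlate : IsLate B K 1 U b₀) : ¬ HasHead B K 1 U b := by
  rintro ⟨x, hxU, hx₁, hx₂, hx⟩
  obtain ⟨y, hyU, hy₁, hy₂, hy⟩ := hlate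
  have hm := Nat.mul_le_mul_right B (show b₀ + 1 ≤ b from hlt)
  rw [Nat.lt_one_iff, rank, card_eq_zero, filter_eq_empty_iff] at hx hy
  have h₁ := hx (mem_seg.2 ⟨hyU, by omega, by omega⟩)
  have h₂ := hy (mem_seg.2 ⟨hxU, by omega, by omega⟩)
  have hne : x ≠ y := by
    rintro rfl
    omega
  exact (precedes_or_precedes hne).elim h₂ h₁

/-! ### Cells and the summary. -/

/-- The index of the cell of a position: cells are the intervals between consecutive
boundaries `b * B` and `b * B + K`. -/
def cellIdx (B K j : ℕ) : ℕ := j / B + (j + (B - K % B)) / B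

/-- Both quotients are monotone in the position, so equality of the sums forces equality of each. -/
theorem cellIdx_eq {B K i j : ℕ} (h : cellIdx B K i = cellIdx B K j) :
    i / B = j / B ∧ (i + (B - K % B)) / B = (j + (B - K % B)) / B := by
  unfold cellIdx at h
  rcases le_total i j with hij | hij
  · have h₁ := Nat.div_le_div_right (c := B) hij
    have h₂ := Nat.div_le_div_right (c := B) (Nat.add_le_add_right hij (B - K % B))
    omega
  · have h₁ := Nat.div_le_div_right (c := B) hij
    have h₂ := Nat.div_le_div_right (c := B) (Nat.add_le_add_right hij (B - K % B))
    omega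

theorem le_iff_of_cellIdx_eq {B K i j : ℕ} (hB : 0 < B) (h : cellIdx B K i = cellIdx B K j)
    (b : ℕ) : b * B ≤ i ↔ b * B ≤ j := by
  rw [← Nat.le_div_iff_mul_le hB, ← Nat.le_div_iff_mul_le hB, (cellIdx_eq h).1]

theorem add_le_iff_of_cellIdx_eq {B K i j : ℕ} (hB : 0 < B)
    (h : cellIdx B K i = cellIdx B K j) (b : ℕ) : b * B + K ≤ i ↔ b * B + K ≤ j := by
  -- The shift moves `K` to a multiple of `B`, so that the second quotient jumps at the positions
  -- congruent to `K` modulo `B`.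
  have hK : K + (B - K % B) = (K / B + 1) * B := by
    have := Nat.mod_lt K hB
    have := Nat.div_add_mod K B
    rw [add_mul, mul_comm (K / B)]
    omega
  have key : ∀ i, b * B + K ≤ i ↔ b + (K / B + 1) ≤ (i + (B - K % B)) / B := fun i => by
    rw [Nat.le_div_iff_mul_le hB, add_mul, ← hK]
    omega
  rw [key, key, (cellIdx_eq h).2]

/-- The entries of `U` preceded by fewer than `l` entries of the same cell. -/
def summary (B K l : ℕ) (U : Finset (ℕ × ℕ)) : Finset (ℕ × ℕ) :=
  {e ∈ U | rank {f ∈ U | cellIdx B K f.1 = cellIdx B K e.1} e < l}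

/-- A union of cells contains the whole cell of each of its entries, so the rank within the cell is
no larger than the rank within the union. -/
theorem rank_lt_subset_of_summary_subset {B K l : ℕ} {U M : Finset (ℕ × ℕ)}
    (hM : summary B K l U ⊆ M) (p : ℕ × ℕ → Prop) [DecidablePred p]
    (hp : ∀ e f : ℕ × ℕ, cellIdx B K e.1 = cellIdx B K f.1 → p f → p e) :
    {f ∈ U.filter p | rank (U.filter p) f < l} ⊆ M.filter p := by
  intro e he
  rw [mem_filter, mem_filter] at he
  refine mem_filter.2 ⟨hM (mem_filter.2 ⟨he.1.1, ?_⟩), he.1.2⟩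
  refine lt_of_le_of_lt (rank_mono (fun f hf => ?_) e) he.2
  rw [mem_filter] at hf ⊢
  exact ⟨hf.1, hp _ _ hf.2 he.1.2⟩

theorem rank_filter_lt_iff {B K l : ℕ} {U M : Finset (ℕ × ℕ)}
    (hM : summary B K l U ⊆ M) (hMU : M ⊆ U) (p : ℕ × ℕ → Prop) [DecidablePred p]
    (hp : ∀ e f : ℕ × ℕ, cellIdx B K e.1 = cellIdx B K f.1 → p f → p e) (e : ℕ × ℕ) :
    rank (M.filter p) e < l ↔ rank (U.filter p) e < l :=
  rank_lt_iff (filter_subset_filter _ hMU) (rank_lt_subset_of_summary_subset hM p hp) e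

theorem rank_cell_lt_iff {B K l : ℕ} {U M : Finset (ℕ × ℕ)}
    (hM : summary B K l U ⊆ M) (hMU : M ⊆ U) (e : ℕ × ℕ) :
    rank {f ∈ M | cellIdx B K f.1 = cellIdx B K e.1} e < l ↔
      rank {f ∈ U | cellIdx B K f.1 = cellIdx B K e.1} e < l :=
  rank_filter_lt_iff hM hMU _ (fun _ _ h h' => h.trans h') e

theorem rank_mid_lt_iff {B K l : ℕ} (hB : 0 < B) {U M : Finset (ℕ × ℕ)}
    (hM : summary B K l U ⊆ M) (hMU : M ⊆ U) (b : ℕ) (e : ℕ × ℕ) :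
    rank (seg M ((b + 1) * B) (b * B + K)) e < l ↔
      rank (seg U ((b + 1) * B) (b * B + K)) e < l := by
  refine rank_filter_lt_iff hM hMU _ (fun e f h h' => ?_) e
  have h₁ := le_iff_of_cellIdx_eq hB h (b + 1)
  have h₂ := add_le_iff_of_cellIdx_eq hB h b
  omega

/-- If a cell-closed set of entries has an entry of rank less than `l` in `T`, then it has one
in the summary. -/
theorem exists_mem_summary {B K l : ℕ} (hl : 1 ≤ l) {U T : Finset (ℕ × ℕ)}
    (p : ℕ × ℕ → Prop) [DecidablePred p]
    (hp : ∀ e f : ℕ × ℕ, cellIdx B K e.1 = cellIdx B K f.1 → p f → p e) {e : ℕ × ℕ}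
    (heU : e ∈ U) (hpe : p e) (he : rank T e < l) :
    ∃ e' ∈ summary B K l U, p e' ∧ rank T e' < l := by
  -- The first entry satisfying `p` is first in its cell, hence in the summary, and its rank in `T`
  -- is at most that of `e`.
  obtain ⟨m, hm, hmin⟩ := (U.filter p).exists_min_image key ⟨e, mem_filter.2 ⟨heU, hpe⟩⟩
  rw [mem_filter] at hm
  refine ⟨m, mem_filter.2 ⟨hm.1, ?_⟩, hm.2, ?_⟩
  · refine lt_of_eq_of_lt ?_ hl
    rw [rank, card_eq_zero, filter_eq_empty_iff]
    intro f hf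
    rw [mem_filter] at hf
    rw [precedes_iff, not_lt]
    exact hmin f (mem_filter.2 ⟨hf.1, hp _ _ hf.2 hm.2⟩)
  · rcases eq_or_ne m e with rfl | hne
    · exact he
    · refine (rank_le_of_precedes ((precedes_or_precedes hne).resolve_right ?_)).trans_lt he
      rw [precedes_iff, not_lt]
      exact hmin e (mem_filter.2 ⟨heU, hpe⟩)

/-- The flag can be read off any memory between the summary and the full set: the tail is a union of
cells, so a witness can be taken in the summary, and comparisons of ranks with `l` in the middle
part agree. -/
theorem isLate_iff {B K l : ℕ} (hB : 0 < B) (hl : 1 ≤ l) {U M : Finset (ℕ × ℕ)}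
    (hM : summary B K l U ⊆ M) (hMU : M ⊆ U) (b : ℕ) :
    IsLate B K l M b ↔ IsLate B K l U b := by
  constructor
  · rintro ⟨e, he, h₁, h₂, h₃⟩
    exact ⟨e, hMU he, h₁, h₂, (rank_mid_lt_iff hB hM hMU b e).1 h₃⟩
  · rintro ⟨e, he, h₁, h₂, h₃⟩
    obtain ⟨e', he', hp, hr⟩ := exists_mem_summary hl
      (fun e => b * B + K ≤ e.1 ∧ e.1 < (b + 1) * B + K) (B := B) (K := K) (fun e f h h' => by
        have h₁ := add_le_iff_of_cellIdx_eq hB h (b + 1)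
        have h₂ := add_le_iff_of_cellIdx_eq hB h b
        omega) he ⟨h₁, h₂⟩ h₃
    exact ⟨e', hM he', hp.1, hp.2, (rank_mid_lt_iff hB hM hMU b e').2 hr⟩

theorem hasHead_iff {B K l : ℕ} (hB : 0 < B) (hl : 1 ≤ l) {U M : Finset (ℕ × ℕ)}
    (hM : summary B K l U ⊆ M) (hMU : M ⊆ U) (b : ℕ) :
    HasHead B K l M b ↔ HasHead B K l U b := by
  constructor
  · rintro ⟨e, he, h₁, h₂, h₃⟩
    exact ⟨e, hMU he, h₁, h₂, (rank_mid_lt_iff hB hM hMU b e).1 h₃⟩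
  · rintro ⟨e, he, h₁, h₂, h₃⟩
    obtain ⟨e', he', hp, hr⟩ := exists_mem_summary hl
      (fun e => b * B ≤ e.1 ∧ e.1 < (b + 1) * B) (B := B) (K := K) (fun e f h h' => by
        have h₁ := le_iff_of_cellIdx_eq hB h (b + 1)
        have h₂ := le_iff_of_cellIdx_eq hB h b
        omega) he ⟨h₁, h₂⟩ h₃
    exact ⟨e', hM he', hp.1, hp.2, (rank_mid_lt_iff hB hM hMU b e').2 hr⟩

theorem card_summary_le {B K l n : ℕ} {U : Finset (ℕ × ℕ)}
    (hn : ∀ e ∈ U, cellIdx B K e.1 < n) : #(summary B K l U) ≤ l * n := by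
  have := card_le_mul_card_image_of_maps_to (s := summary B K l U) (t := range n)
    (f := fun e => cellIdx B K e.1) (fun e he => mem_range.2 (hn e (mem_filter.1 he).1)) l
    (fun c _ => by
      have h := card_rank_lt {f ∈ U | cellIdx B K f.1 = c} l
      refine le_trans (card_le_card fun e he => ?_) (h.le.trans (min_le_left _ _))
      obtain ⟨he₁, he₂⟩ := mem_filter.1 he
      obtain ⟨he₁, he₃⟩ := mem_filter.1 he₁
      subst he₂
      exact mem_filter.2 ⟨mem_filter.2 ⟨he₁, rfl⟩, he₃⟩)
  simpa using this

/-! ### Closure properties of primitive recursive functions and predicates. -/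

section Primrec

variable {α β σ : Type*} [Primcodable α] [Primcodable β] [Primcodable σ]

theorem primrec_filter {f : α → List β} {p : α → β → Prop} [∀ a, DecidablePred (p a)]
    (hf : Primrec f) (hp : PrimrecPred fun x : α × β => p x.1 x.2) :
    Primrec fun a => (f a).filter fun b => decide (p a b) := by
  have hg : Primrec₂ fun a b => if p a b then some b else none :=
    Primrec.ite hp (Primrec.option_some.comp Primrec.snd) (Primrec.const none)
  refine (Primrec.listFilterMap hf hg).of_eq fun a => ?_
  rw [← List.filterMap_eq_filter]
  refine List.filterMap_congr fun b _ => ?_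
  simp [Option.guard]

theorem primrecPred_exists_mem {f : α → List β} {p : α → β → Prop} (hf : Primrec f)
    (hp : PrimrecPred fun x : α × β => p x.1 x.2) :
    PrimrecPred fun a => ∃ b ∈ f a, p a b := by
  have h : PrimrecRel fun (b : β) (a : α) => p a b := by
    have := hp.comp (f := fun x : β × α => (x.2, x.1)) (Primrec.snd.pair Primrec.fst)
    exact this
  exact h.exists_mem_list.comp hf Primrec.id

theorem primrecPred_lt {f g : α → ℕ} (hf : Primrec f) (hg : Primrec g) :
    PrimrecPred fun a => f a < g a := Primrec.nat_lt.comp hf hg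

theorem primrecPred_le {f g : α → ℕ} (hf : Primrec f) (hg : Primrec g) :
    PrimrecPred fun a => f a ≤ g a := Primrec.nat_le.comp hf hg

theorem primrecPred_eq {f g : α → β} (hf : Primrec f) (hg : Primrec g) :
    PrimrecPred fun a => f a = g a := Primrec.eq.comp hf hg

theorem primrec_pow {f g : α → ℕ} (hf : Primrec f) (hg : Primrec g) :
    Primrec fun a => f a ^ g a :=
  (Primrec₂.unpaired'.1 Nat.Primrec.pow).comp hf hg

theorem primrec_decide {p : α → Prop} [DecidablePred p] (hp : PrimrecPred p) :
    Primrec fun a => decide (p a) := primrecPred_iff_primrec_decide.1 hp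

theorem primrecPred_precedes {f e : α → ℕ × ℕ} (hf : Primrec f) (he : Primrec e) :
    PrimrecPred fun a => precedes (f a) (e a) :=
  (primrecPred_lt (Primrec.snd.comp hf) (Primrec.snd.comp he)).or
    ((primrecPred_eq (Primrec.snd.comp hf) (Primrec.snd.comp he)).and
      (primrecPred_lt (Primrec.fst.comp hf) (Primrec.fst.comp he)))

end Primrec

/-! ### The algorithm on lists and its binary encoding. -/

/-- `rank (seg M lo hi) e`, on lists. -/
def listRank (lo hi : ℕ) (M : List (ℕ × ℕ)) (e : ℕ × ℕ) : ℕ :=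
  (M.filter fun f => decide ((lo ≤ f.1 ∧ f.1 < hi) ∧ precedes f e)).length

/-- The rank of `e` among the entries of its cell, on lists. -/
def listCellRank (B K : ℕ) (M : List (ℕ × ℕ)) (e : ℕ × ℕ) : ℕ :=
  (M.filter fun f => decide (cellIdx B K f.1 = cellIdx B K e.1 ∧ precedes f e)).length

/-- `IsLate` on lists. -/
def listLate (B K l : ℕ) (M : List (ℕ × ℕ)) (b : ℕ) : Bool :=
  decide (∃ e ∈ M, b * B + K ≤ e.1 ∧ e.1 < (b + 1) * B + K ∧
    listRank ((b + 1) * B) (b * B + K) M e < l)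

/-- `HasHead` on lists. -/
def listHead (B K l : ℕ) (M : List (ℕ × ℕ)) (b : ℕ) : Bool :=
  decide (∃ e ∈ M, b * B ≤ e.1 ∧ e.1 < (b + 1) * B ∧
    listRank ((b + 1) * B) (b * B + K) M e < l)

/-- The earliest number of elements of a pass after which window `i` is answered: late windows wait
for their last element, other windows are known soon after their block. -/
def ownTime (B K : ℕ) (late : ℕ → Bool) (i : ℕ) : ℕ :=
  i + if late (i / B) = true then K else min (2 * B) K

/-- The running maximum of `ownTime`. -/
def outTime (B K : ℕ) (late : ℕ → Bool) : ℕ → ℕ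
  | 0 => ownTime B K late 0
  | i + 1 => max (outTime B K late i) (ownTime B K late (i + 1))

/-- The windows answered in the second output pass. -/
def IsSecond (B K : ℕ) (late head : ℕ → Bool) (i : ℕ) : Prop :=
  ¬ late (i / B) = true ∧ head (i / B) = true ∧ ownTime B K late i < outTime B K late i

instance (B K : ℕ) (late head : ℕ → Bool) (i : ℕ) : Decidable (IsSecond B K late head i) :=
  inferInstanceAs (Decidable (_ ∧ _))

/-- Window `i` is answered when the element at position `t` of pass `q` is read. -/
def Emits (B K : ℕ) (late head : ℕ → Bool) (q t i : ℕ) : Prop :=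
  (q = 1 ∧ ¬ IsSecond B K late head i ∧ outTime B K late i = t + 1) ∨
    (q = 2 ∧ IsSecond B K late head i ∧ ownTime B K late i = t + 1)

instance (B K : ℕ) (late head : ℕ → Bool) (q t i : ℕ) : Decidable (Emits B K late head q t i) :=
  inferInstanceAs (Decidable (_ ∨ _))

/-- Entry `e` is held beyond the summary when `t` elements of pass `q` have been read. -/
def Holds (B K : ℕ) (late head : ℕ → Bool) (q t : ℕ) (e : ℕ × ℕ) : Prop :=
  1 ≤ q ∧ e.1 < t ∧
    (t < e.1 + 2 * B ∨ (late (e.1 / B) = true ∧ head (e.1 / B) = true ∧ t < e.1 + K))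

instance (B K : ℕ) (late head : ℕ → Bool) (q t : ℕ) (e : ℕ × ℕ) :
    Decidable (Holds B K late head q t e) :=
  inferInstanceAs (Decidable (_ ∧ _))

/-- The value of rank `l` in the window that starts at `i`. -/
def listValue (l K : ℕ) (M : List (ℕ × ℕ)) (i : ℕ) : ℕ :=
  ((M.filter fun e =>
    decide ((i ≤ e.1 ∧ e.1 < i + K) ∧ listRank i (i + K) M e + 1 = l)).headI).2

/-- Add an entry to a list without repetition. -/
def addEntry (e : ℕ × ℕ) (M : List (ℕ × ℕ)) : List (ℕ × ℕ) :=
  if ∃ f ∈ M, f = e then M else e :: M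

/-- The clock `(pass, position)` after reading one more element; passes from the third on
are not distinguished. -/
def tick (N : ℕ) (c : ℕ × ℕ) : ℕ × ℕ :=
  if c.2 + 1 < N then (c.1, c.2 + 1) else (min (c.1 + 1) 3, 0)

/-- The entries kept from `M` at clock `c`. -/
def listKeep (B K l : ℕ) (c : ℕ × ℕ) (M : List (ℕ × ℕ)) : List (ℕ × ℕ) :=
  M.filter fun e => decide (listCellRank B K M e < l ∨
    Holds B K (listLate B K l M) (listHead B K l M) c.1 c.2 e)

/-- The entries written at clock `c`. -/
def listEmit (l N K B : ℕ) (c : ℕ × ℕ) (M : List (ℕ × ℕ)) : List (ℕ × ℕ) :=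
  ((List.range (N - K + 1)).filter fun i =>
    decide (Emits B K (listLate B K l M) (listHead B K l M) c.1 c.2 i)).map
      fun i => (i, listValue l K M i)

/-- The `w` low binary digits of `n`. -/
def bits (w n : ℕ) : List Bool := (List.range w).map fun k => decide (n / 2 ^ k % 2 = 1)

/-- The number with `w` binary digits in `s`, starting at offset `o`. -/
def unbits (s : List Bool) (o : ℕ) : ℕ → ℕ
  | 0 => 0
  | w + 1 => unbits s o w + if s.getD (o + w) false = true then 2 ^ w else 0

/-- Bit string of a list of pairs of `w`-digit numbers. -/
def pack (w : ℕ) (L : List (ℕ × ℕ)) : List Bool := L.flatMap fun e => bits w e.1 ++ bits w e.2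

/-- The list of pairs of `w`-digit numbers in a bit string. -/
def unpack (w : ℕ) (s : List Bool) : List (ℕ × ℕ) :=
  (List.range (s.length / (2 * w))).map fun k =>
    (unbits s (2 * w * k) w, unbits s (2 * w * k + w) w)

/-- Number of binary digits for all numbers in the memory. -/
def width (N R : ℕ) : ℕ := Nat.log 2 (N + R + 4) + 1

/-- The length of a block. -/
def blockLength (N : ℕ) : ℕ := Nat.sqrt N + 1

/-- One step of the algorithm on unpacked memory: `L` is the clock followed by the entries held. -/
def listStep (l N K B : ℕ) (L : List (ℕ × ℕ)) (x : ℕ) : List (ℕ × ℕ) × List (ℕ × ℕ) :=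
  (tick N L.headI ::
      listKeep B K l (tick N L.headI) (addEntry (L.headI.2, x) L.tail),
    listEmit l N K B L.headI (addEntry (L.headI.2, x) L.tail))

/-! ### The algorithm is primitive recursive, hence computable. -/

section Primrec

variable {α : Type*} [Primcodable α]

theorem primrec_cellIdx {B K j : α → ℕ} (hB : Primrec B) (hK : Primrec K) (hj : Primrec j) :
    Primrec fun a => cellIdx (B a) (K a) (j a) :=
  Primrec.nat_add.comp (Primrec.nat_div.comp hj hB) (Primrec.nat_div.comp
    (Primrec.nat_add.comp hj (Primrec.nat_sub.comp hB (Primrec.nat_mod.comp hK hB))) hB)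

theorem primrec_listRank {lo hi : α → ℕ} {M : α → List (ℕ × ℕ)} {e : α → ℕ × ℕ}
    (hlo : Primrec lo) (hhi : Primrec hi) (hM : Primrec M) (he : Primrec e) :
    Primrec fun a => listRank (lo a) (hi a) (M a) (e a) := by
  refine Primrec.list_length.comp (primrec_filter hM ?_)
  have hf : Primrec fun x : α × ℕ × ℕ => x.2.1 := Primrec.fst.comp Primrec.snd
  exact ((primrecPred_le (hlo.comp Primrec.fst) hf).and
    (primrecPred_lt hf (hhi.comp Primrec.fst))).and
      (primrecPred_precedes Primrec.snd (he.comp Primrec.fst))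

theorem primrec_listCellRank {B K : α → ℕ} {M : α → List (ℕ × ℕ)} {e : α → ℕ × ℕ}
    (hB : Primrec B) (hK : Primrec K) (hM : Primrec M) (he : Primrec e) :
    Primrec fun a => listCellRank (B a) (K a) (M a) (e a) := by
  refine Primrec.list_length.comp (primrec_filter hM ?_)
  have hf : Primrec fun x : α × ℕ × ℕ => x.2.1 := Primrec.fst.comp Primrec.snd
  exact (primrecPred_eq (primrec_cellIdx (hB.comp Primrec.fst) (hK.comp Primrec.fst) hf)
      (primrec_cellIdx (hB.comp Primrec.fst) (hK.comp Primrec.fst)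
        (Primrec.fst.comp (he.comp Primrec.fst)))).and
    (primrecPred_precedes Primrec.snd (he.comp Primrec.fst))

theorem primrec_blockStart {B b : α → ℕ} (hB : Primrec B) (hb : Primrec b) :
    Primrec fun a => b a * B a := Primrec.nat_mul.comp hb hB

theorem primrec_blockEnd {B b : α → ℕ} (hB : Primrec B) (hb : Primrec b) :
    Primrec fun a => (b a + 1) * B a := Primrec.nat_mul.comp (Primrec.succ.comp hb) hB

theorem primrec_listLate {B K l b : α → ℕ} {M : α → List (ℕ × ℕ)} (hB : Primrec B)
    (hK : Primrec K) (hl : Primrec l) (hM : Primrec M) (hb : Primrec b) :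
    Primrec fun a => listLate (B a) (K a) (l a) (M a) (b a) := by
  refine primrec_decide (primrecPred_exists_mem hM ?_)
  have hf : Primrec fun x : α × ℕ × ℕ => x.2.1 := Primrec.fst.comp Primrec.snd
  have h₁ := (primrec_blockStart hB hb).comp (Primrec.fst (α := α) (β := ℕ × ℕ))
  have h₂ := (primrec_blockEnd hB hb).comp (Primrec.fst (α := α) (β := ℕ × ℕ))
  have hK' := hK.comp (Primrec.fst (α := α) (β := ℕ × ℕ))
  exact (primrecPred_le (Primrec.nat_add.comp h₁ hK') hf).and
    ((primrecPred_lt hf (Primrec.nat_add.comp h₂ hK')).and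
      (primrecPred_lt (primrec_listRank h₂ (Primrec.nat_add.comp h₁ hK')
        (hM.comp Primrec.fst) Primrec.snd) (hl.comp Primrec.fst)))

theorem primrec_listHead {B K l b : α → ℕ} {M : α → List (ℕ × ℕ)} (hB : Primrec B)
    (hK : Primrec K) (hl : Primrec l) (hM : Primrec M) (hb : Primrec b) :
    Primrec fun a => listHead (B a) (K a) (l a) (M a) (b a) := by
  refine primrec_decide (primrecPred_exists_mem hM ?_)
  have hf : Primrec fun x : α × ℕ × ℕ => x.2.1 := Primrec.fst.comp Primrec.snd
  have h₁ := (primrec_blockStart hB hb).comp (Primrec.fst (α := α) (β := ℕ × ℕ))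
  have h₂ := (primrec_blockEnd hB hb).comp (Primrec.fst (α := α) (β := ℕ × ℕ))
  have hK' := hK.comp (Primrec.fst (α := α) (β := ℕ × ℕ))
  exact (primrecPred_le h₁ hf).and ((primrecPred_lt hf h₂).and
      (primrecPred_lt (primrec_listRank h₂ (Primrec.nat_add.comp h₁ hK')
        (hM.comp Primrec.fst) Primrec.snd) (hl.comp Primrec.fst)))

theorem primrec_ownTime {B K i : α → ℕ} {late : α → ℕ → Bool} (hB : Primrec B)
    (hK : Primrec K) (hlate : Primrec₂ late) (hi : Primrec i) :
    Primrec fun a => ownTime (B a) (K a) (late a) (i a) :=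
  Primrec.nat_add.comp hi (Primrec.ite
    (primrecPred_eq (hlate.comp Primrec.id (Primrec.nat_div.comp hi hB)) (Primrec.const true))
    hK (Primrec.nat_min.comp (Primrec.nat_mul.comp (Primrec.const 2) hB) hK))

theorem primrec_outTime {B K i : α → ℕ} {late : α → ℕ → Bool} (hB : Primrec B)
    (hK : Primrec K) (hlate : Primrec₂ late) (hi : Primrec i) :
    Primrec fun a => outTime (B a) (K a) (late a) (i a) := by
  have hstep : Primrec₂ fun (a : α) (x : ℕ × ℕ) =>
      max x.2 (ownTime (B a) (K a) (late a) (x.1 + 1)) := by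
    have hlate' : Primrec₂ fun (y : α × ℕ × ℕ) (b : ℕ) => late y.1 b :=
      hlate.comp (Primrec.fst.comp Primrec.fst) Primrec.snd
    exact Primrec.nat_max.comp (Primrec.snd.comp Primrec.snd)
      (primrec_ownTime (hB.comp Primrec.fst) (hK.comp Primrec.fst) hlate'
        (Primrec.succ.comp (Primrec.fst.comp Primrec.snd)))
  refine (Primrec.nat_rec' hi (primrec_ownTime hB hK hlate (Primrec.const 0)) hstep).of_eq
    fun a => ?_
  induction i a with
  | zero => rfl
  | succ n ih => simp only [outTime, ← ih]

theorem primrecPred_isSecond {B K i : α → ℕ} {late head : α → ℕ → Bool} (hB : Primrec B)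
    (hK : Primrec K) (hlate : Primrec₂ late) (hhead : Primrec₂ head) (hi : Primrec i) :
    PrimrecPred fun a => IsSecond (B a) (K a) (late a) (head a) (i a) :=
  (primrecPred_eq (hlate.comp Primrec.id (Primrec.nat_div.comp hi hB))
      (Primrec.const true)).not.and
    ((primrecPred_eq (hhead.comp Primrec.id (Primrec.nat_div.comp hi hB))
      (Primrec.const true)).and
      (primrecPred_lt (primrec_ownTime hB hK hlate hi) (primrec_outTime hB hK hlate hi)))

theorem primrecPred_emits {B K q t i : α → ℕ} {late head : α → ℕ → Bool} (hB : Primrec B)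
    (hK : Primrec K) (hlate : Primrec₂ late) (hhead : Primrec₂ head) (hq : Primrec q)
    (ht : Primrec t) (hi : Primrec i) :
    PrimrecPred fun a => Emits (B a) (K a) (late a) (head a) (q a) (t a) (i a) := by
  have hs := primrecPred_isSecond hB hK hlate hhead hi
  have ht' : Primrec fun a => t a + 1 := Primrec.succ.comp ht
  exact ((primrecPred_eq hq (Primrec.const 1)).and
      (hs.not.and (primrecPred_eq (primrec_outTime hB hK hlate hi) ht'))).or
    ((primrecPred_eq hq (Primrec.const 2)).and
      (hs.and (primrecPred_eq (primrec_ownTime hB hK hlate hi) ht')))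

theorem primrecPred_holds {B K q t : α → ℕ} {e : α → ℕ × ℕ} {late head : α → ℕ → Bool}
    (hB : Primrec B) (hK : Primrec K) (hlate : Primrec₂ late) (hhead : Primrec₂ head)
    (hq : Primrec q) (ht : Primrec t) (he : Primrec e) :
    PrimrecPred fun a => Holds (B a) (K a) (late a) (head a) (q a) (t a) (e a) := by
  have he' : Primrec fun a => (e a).1 := Primrec.fst.comp he
  have hb := Primrec.nat_div.comp he' hB
  exact (primrecPred_le (Primrec.const 1) hq).and ((primrecPred_lt he' ht).and
    ((primrecPred_lt ht (Primrec.nat_add.comp he' (Primrec.nat_mul.comp (Primrec.const 2) hB))).or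
      ((primrecPred_eq (hlate.comp Primrec.id hb) (Primrec.const true)).and
        ((primrecPred_eq (hhead.comp Primrec.id hb) (Primrec.const true)).and
          (primrecPred_lt ht (Primrec.nat_add.comp he' hK))))))

theorem primrec_listValue {l K i : α → ℕ} {M : α → List (ℕ × ℕ)} (hl : Primrec l)
    (hK : Primrec K) (hM : Primrec M) (hi : Primrec i) :
    Primrec fun a => listValue (l a) (K a) (M a) (i a) := by
  refine Primrec.snd.comp (Primrec.list_headI.comp (primrec_filter hM ?_))
  have hf : Primrec fun x : α × ℕ × ℕ => x.2.1 := Primrec.fst.comp Primrec.snd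
  have hi' := hi.comp (Primrec.fst (α := α) (β := ℕ × ℕ))
  have hj := Primrec.nat_add.comp hi' (hK.comp (Primrec.fst (α := α) (β := ℕ × ℕ)))
  exact ((primrecPred_le hi' hf).and (primrecPred_lt hf hj)).and
    (primrecPred_eq (Primrec.succ.comp (primrec_listRank hi' hj (hM.comp Primrec.fst)
      Primrec.snd)) (hl.comp Primrec.fst))

theorem primrec_addEntry {e : α → ℕ × ℕ} {M : α → List (ℕ × ℕ)} (he : Primrec e)
    (hM : Primrec M) : Primrec fun a => addEntry (e a) (M a) :=
  Primrec.ite (primrecPred_exists_mem hM (primrecPred_eq Primrec.snd (he.comp Primrec.fst))) hM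
    (Primrec.list_cons.comp he hM)

theorem primrec_tick {N : α → ℕ} {c : α → ℕ × ℕ} (hN : Primrec N) (hc : Primrec c) :
    Primrec fun a => tick (N a) (c a) := by
  have h₁ : Primrec fun a => (c a).1 := Primrec.fst.comp hc
  have h₂ : Primrec fun a => (c a).2 + 1 := Primrec.succ.comp (Primrec.snd.comp hc)
  exact Primrec.ite (primrecPred_lt h₂ hN) (h₁.pair h₂)
    ((Primrec.nat_min.comp (Primrec.succ.comp h₁) (Primrec.const 3)).pair (Primrec.const 0))

theorem primrec₂_listLate {β : Type*} [Primcodable β] {B K l : α → ℕ} {M : α → List (ℕ × ℕ)}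
    (hB : Primrec B) (hK : Primrec K) (hl : Primrec l) (hM : Primrec M) :
    Primrec₂ fun (y : α × β) (b : ℕ) => listLate (B y.1) (K y.1) (l y.1) (M y.1) b := by
  have h : Primrec fun z : (α × β) × ℕ => z.1.1 := Primrec.fst.comp Primrec.fst
  exact primrec_listLate (hB.comp h) (hK.comp h) (hl.comp h) (hM.comp h) Primrec.snd

theorem primrec₂_listHead {β : Type*} [Primcodable β] {B K l : α → ℕ} {M : α → List (ℕ × ℕ)}
    (hB : Primrec B) (hK : Primrec K) (hl : Primrec l) (hM : Primrec M) :
    Primrec₂ fun (y : α × β) (b : ℕ) => listHead (B y.1) (K y.1) (l y.1) (M y.1) b := by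
  have h : Primrec fun z : (α × β) × ℕ => z.1.1 := Primrec.fst.comp Primrec.fst
  exact primrec_listHead (hB.comp h) (hK.comp h) (hl.comp h) (hM.comp h) Primrec.snd

theorem primrec_listKeep {B K l : α → ℕ} {c : α → ℕ × ℕ} {M : α → List (ℕ × ℕ)}
    (hB : Primrec B) (hK : Primrec K) (hl : Primrec l) (hc : Primrec c) (hM : Primrec M) :
    Primrec fun a => listKeep (B a) (K a) (l a) (c a) (M a) := by
  refine primrec_filter hM ?_
  have h : Primrec fun x : α × ℕ × ℕ => x.1 := Primrec.fst
  exact (primrecPred_lt (primrec_listCellRank (hB.comp h) (hK.comp h) (hM.comp h) Primrec.snd)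
      (hl.comp h)).or
    (primrecPred_holds (hB.comp h) (hK.comp h) (primrec₂_listLate hB hK hl hM)
      (primrec₂_listHead hB hK hl hM) (Primrec.fst.comp (hc.comp h))
      (Primrec.snd.comp (hc.comp h)) Primrec.snd)

theorem primrec_listEmit {l N K B : α → ℕ} {c : α → ℕ × ℕ} {M : α → List (ℕ × ℕ)}
    (hl : Primrec l) (hN : Primrec N) (hK : Primrec K) (hB : Primrec B) (hc : Primrec c)
    (hM : Primrec M) : Primrec fun a => listEmit (l a) (N a) (K a) (B a) (c a) (M a) := by
  have h : Primrec fun x : α × ℕ => x.1 := Primrec.fst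
  refine Primrec.list_map (primrec_filter (Primrec.list_range.comp
    (Primrec.succ.comp (Primrec.nat_sub.comp hN hK))) ?_)
    (Primrec.snd.pair (primrec_listValue (hl.comp h) (hK.comp h) (hM.comp h) Primrec.snd))
  exact primrecPred_emits (hB.comp h) (hK.comp h) (primrec₂_listLate hB hK hl hM)
    (primrec₂_listHead hB hK hl hM) (Primrec.fst.comp (hc.comp h))
    (Primrec.snd.comp (hc.comp h)) Primrec.snd

theorem primrec_bits {w n : α → ℕ} (hw : Primrec w) (hn : Primrec n) :
    Primrec fun a => bits (w a) (n a) := by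
  refine Primrec.list_map (Primrec.list_range.comp hw) (primrec_decide ?_)
  exact primrecPred_eq (Primrec.nat_mod.comp (Primrec.nat_div.comp (hn.comp Primrec.fst)
    (primrec_pow (Primrec.const 2) Primrec.snd)) (Primrec.const 2)) (Primrec.const 1)

theorem primrec_unbits {s : α → List Bool} {o w : α → ℕ} (hs : Primrec s) (ho : Primrec o)
    (hw : Primrec w) : Primrec fun a => unbits (s a) (o a) (w a) := by
  have hstep : Primrec₂ fun (a : α) (x : ℕ × ℕ) =>
      x.2 + if (s a).getD (o a + x.1) false = true then 2 ^ x.1 else 0 := by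
    have h₁ : Primrec fun y : α × ℕ × ℕ => y.2.1 := Primrec.fst.comp Primrec.snd
    have h : Primrec fun y : α × ℕ × ℕ => y.1 := Primrec.fst
    exact Primrec.nat_add.comp (Primrec.snd.comp Primrec.snd) (Primrec.ite
      (primrecPred_eq ((Primrec.list_getD false).comp (hs.comp h)
        (Primrec.nat_add.comp (ho.comp h) h₁)) (Primrec.const true))
      (primrec_pow (Primrec.const 2) h₁) (Primrec.const 0))
  refine (Primrec.nat_rec' hw (Primrec.const 0) hstep).of_eq fun a => ?_
  induction w a with
  | zero => rfl
  | succ n ih => simp only [unbits, ← ih]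

theorem primrec_pack {w : α → ℕ} {L : α → List (ℕ × ℕ)} (hw : Primrec w) (hL : Primrec L) :
    Primrec fun a => pack (w a) (L a) :=
  Primrec.list_flatMap hL (Primrec.list_append.comp
    (primrec_bits (hw.comp Primrec.fst) (Primrec.fst.comp Primrec.snd))
    (primrec_bits (hw.comp Primrec.fst) (Primrec.snd.comp Primrec.snd)))

theorem primrec_unpack {w : α → ℕ} {s : α → List Bool} (hw : Primrec w) (hs : Primrec s) :
    Primrec fun a => unpack (w a) (s a) := by
  have h2w : Primrec fun a => 2 * w a := Primrec.nat_mul.comp (Primrec.const 2) hw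
  have hk : Primrec fun x : α × ℕ => 2 * w x.1 * x.2 :=
    Primrec.nat_mul.comp (h2w.comp Primrec.fst) Primrec.snd
  have hw' : Primrec fun x : α × ℕ => w x.1 := hw.comp Primrec.fst
  have hs' : Primrec fun x : α × ℕ => s x.1 := hs.comp Primrec.fst
  exact Primrec.list_map (Primrec.list_range.comp
    (Primrec.nat_div.comp (Primrec.list_length.comp hs) h2w))
    ((primrec_unbits hs' hk hw').pair (primrec_unbits hs' (Primrec.nat_add.comp hk hw') hw'))

theorem primrec_width {N R : α → ℕ} (hN : Primrec N) (hR : Primrec R) :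
    Primrec fun a => width (N a) (R a) := by
  have hn : Primrec fun a => N a + R a + 4 :=
    Primrec.nat_add.comp (Primrec.nat_add.comp hN hR) (Primrec.const 4)
  -- The binary logarithm of `n` is the greatest `k ≤ n` with `2 ^ k ≤ n`, a bounded search.
  refine Primrec.succ.comp ((Primrec.nat_findGreatest (p := fun a k => 2 ^ k ≤ N a + R a + 4) hn
    (primrecPred_le (primrec_pow (Primrec.const 2) Primrec.snd)
      (hn.comp Primrec.fst)).primrecRel).of_eq fun a => ?_)
  rw [Nat.findGreatest_eq_iff]
  refine ⟨Nat.log_le_self _ _, fun _ => Nat.pow_log_le_self 2 (by omega), fun k h _ h' => ?_⟩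
  exact absurd (Nat.lt_pow_of_log_lt (by norm_num) h) (not_lt.2 h')

theorem primrec_blockLength {N : α → ℕ} (hN : Primrec N) :
    Primrec fun a => blockLength (N a) := Primrec.succ.comp (Primrec.nat_sqrt.comp hN)

theorem primrec_listStep {l N K B x : α → ℕ} {L : α → List (ℕ × ℕ)} (hl : Primrec l)
    (hN : Primrec N) (hK : Primrec K) (hB : Primrec B) (hL : Primrec L) (hx : Primrec x) :
    Primrec fun a => listStep (l a) (N a) (K a) (B a) (L a) (x a) := by
  have hc := Primrec.list_headI.comp hL
  have hM := primrec_addEntry ((Primrec.snd.comp hc).pair hx) (Primrec.list_tail.comp hL)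
  have ht := primrec_tick hN hc
  exact (Primrec.list_cons.comp ht (primrec_listKeep hB hK hl ht hM)).pair
    (primrec_listEmit hl hN hK hB hc hM)

end Primrec

/-- The streaming algorithm, with parameters `(l, N, K, R)`. -/
def alg : StreamAlg (ℕ × ℕ × ℕ × ℕ) where
  init p := pack (width p.2.1 p.2.2.2) [(0, 0)]
  step p m x :=
    let s := listStep p.1 p.2.1 p.2.2.1 (blockLength p.2.1) (unpack (width p.2.1 p.2.2.2) m) x
    (pack (width p.2.1 p.2.2.2) s.1, s.2)
  init_computable := by
    have hN : Primrec fun p : ℕ × ℕ × ℕ × ℕ => p.2.1 := Primrec.fst.comp Primrec.snd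
    have hR : Primrec fun p : ℕ × ℕ × ℕ × ℕ => p.2.2.2 :=
      Primrec.snd.comp (Primrec.snd.comp Primrec.snd)
    exact (primrec_pack (primrec_width hN hR) (Primrec.const [(0, 0)])).to_comp
  step_computable := by
    have hl : Primrec fun x : (ℕ × ℕ × ℕ × ℕ) × List Bool × ℕ => x.1.1 :=
      Primrec.fst.comp Primrec.fst
    have hp : Primrec fun x : (ℕ × ℕ × ℕ × ℕ) × List Bool × ℕ => x.1.2 :=
      Primrec.snd.comp Primrec.fst
    have hN : Primrec fun x : (ℕ × ℕ × ℕ × ℕ) × List Bool × ℕ => x.1.2.1 :=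
      Primrec.fst.comp hp
    have hK : Primrec fun x : (ℕ × ℕ × ℕ × ℕ) × List Bool × ℕ => x.1.2.2.1 :=
      Primrec.fst.comp (Primrec.snd.comp hp)
    have hR : Primrec fun x : (ℕ × ℕ × ℕ × ℕ) × List Bool × ℕ => x.1.2.2.2 :=
      Primrec.snd.comp (Primrec.snd.comp hp)
    have hs := primrec_listStep hl hN hK (primrec_blockLength hN)
      (primrec_unpack (primrec_width hN hR) (Primrec.fst.comp Primrec.snd))
      (Primrec.snd.comp Primrec.snd)
    exact ((primrec_pack (primrec_width hN hR) (Primrec.fst.comp hs)).pair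
      (Primrec.snd.comp hs)).to_comp

/-! ### Decoding inverts encoding. -/

theorem length_bits (w n : ℕ) : (bits w n).length = w := by simp [bits]

theorem getD_bits {w i : ℕ} (hi : i < w) (n : ℕ) :
    (bits w n).getD i false = decide (n / 2 ^ i % 2 = 1) := by
  rw [List.getD_eq_getElem _ _ (by rwa [length_bits])]
  simp [bits]

theorem length_pack (w : ℕ) (L : List (ℕ × ℕ)) : (pack w L).length = 2 * w * L.length := by
  induction L with
  | nil => rfl
  | cons e L ih =>
    have : pack w (e :: L) = (bits w e.1 ++ bits w e.2) ++ pack w L := by simp [pack]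
    rw [this, List.length_append, List.length_append, ih, length_bits, length_bits,
      List.length_cons]
    ring

theorem getD_pack {w i : ℕ} (hi : i < w) (L : List (ℕ × ℕ)) (k : ℕ) (hk : k < L.length) :
    (pack w L).getD (2 * w * k + i) false = decide (L[k].1 / 2 ^ i % 2 = 1) ∧
      (pack w L).getD (2 * w * k + w + i) false = decide (L[k].2 / 2 ^ i % 2 = 1) := by
  induction L generalizing k with
  | nil => simp at hk
  | cons e L ih =>
    have hp : pack w (e :: L) = (bits w e.1 ++ bits w e.2) ++ pack w L := by simp [pack]
    have hlen : (bits w e.1 ++ bits w e.2).length = 2 * w := by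
      rw [List.length_append, length_bits, length_bits]
      ring
    rw [hp]
    cases k with
    | zero =>
      rw [mul_zero, zero_add, zero_add]
      constructor
      · rw [List.getD_append _ _ _ _ (by omega),
          List.getD_append _ _ _ _ (by rw [length_bits]; omega), getD_bits hi]
        rfl
      · rw [List.getD_append _ _ _ _ (by omega),
          List.getD_append_right _ _ _ _ (by rw [length_bits]; omega), length_bits,
          Nat.add_sub_cancel_left, getD_bits hi]
        rfl
    | succ k =>
      have hmul : 2 * w * (k + 1) = 2 * w * k + 2 * w := by ring
      rw [List.getD_append_right _ _ _ _ (by omega), List.getD_append_right _ _ _ _ (by omega),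
        hlen]
      have h₁ : 2 * w * (k + 1) + i - 2 * w = 2 * w * k + i := by omega
      have h₂ : 2 * w * (k + 1) + w + i - 2 * w = 2 * w * k + w + i := by omega
      rw [h₁, h₂]
      exact ih k (by simpa using hk)

theorem unbits_eq {s : List Bool} {o w n : ℕ}
    (h : ∀ i < w, s.getD (o + i) false = decide (n / 2 ^ i % 2 = 1)) :
    unbits s o w = n % 2 ^ w := by
  induction w with
  | zero => simp [unbits, Nat.mod_one]
  | succ w ih =>
    rw [unbits, ih fun i hi => h i (by omega), h w (by omega), Nat.mod_pow_succ]
    rcases Nat.mod_two_eq_zero_or_one (n / 2 ^ w) with h' | h' <;> simp [h']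

theorem unpack_pack {w : ℕ} (hw : 0 < w) {L : List (ℕ × ℕ)}
    (hL : ∀ e ∈ L, e.1 < 2 ^ w ∧ e.2 < 2 ^ w) : unpack w (pack w L) = L := by
  have hlen : (pack w L).length / (2 * w) = L.length := by
    rw [length_pack, Nat.mul_div_cancel_left _ (by omega)]
  refine List.ext_getElem (by simp [unpack, hlen]) fun k h₁ h₂ => ?_
  have hk := hL L[k] (List.getElem_mem h₂)
  simp only [unpack, List.getElem_map, List.getElem_range]
  rw [unbits_eq fun i hi => (getD_pack hi L k h₂).1,
    unbits_eq fun i hi => (getD_pack hi L k h₂).2, Nat.mod_eq_of_lt hk.1, Nat.mod_eq_of_lt hk.2]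

/-! ### List computations agree with the finite-set notions. -/

theorem length_filter_eq_card {M : List (ℕ × ℕ)} (hM : M.Nodup) (p : ℕ × ℕ → Prop)
    [DecidablePred p] : (M.filter fun f => decide (p f)).length = #{f ∈ M.toFinset | p f} := by
  rw [← List.toFinset_card_of_nodup (hM.filter _), List.toFinset_filter]
  simp

theorem listRank_eq {M : List (ℕ × ℕ)} (hM : M.Nodup) (lo hi : ℕ) (e : ℕ × ℕ) :
    listRank lo hi M e = rank (seg M.toFinset lo hi) e := by
  rw [listRank, length_filter_eq_card hM, rank, seg, filter_filter]

theorem listCellRank_eq {M : List (ℕ × ℕ)} (hM : M.Nodup) (B K : ℕ) (e : ℕ × ℕ) :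
    listCellRank B K M e =
      rank {f ∈ M.toFinset | cellIdx B K f.1 = cellIdx B K e.1} e := by
  rw [listCellRank, length_filter_eq_card hM, rank, filter_filter]

open Classical in
/-- `IsLate` as a Boolean function. -/
noncomputable def lateFn (B K l : ℕ) (U : Finset (ℕ × ℕ)) (b : ℕ) : Bool :=
  decide (IsLate B K l U b)

open Classical in
/-- `HasHead` as a Boolean function. -/
noncomputable def headFn (B K l : ℕ) (U : Finset (ℕ × ℕ)) (b : ℕ) : Bool :=
  decide (HasHead B K l U b)

theorem lateFn_eq_true {B K l : ℕ} {U : Finset (ℕ × ℕ)} {b : ℕ} :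
    lateFn B K l U b = true ↔ IsLate B K l U b := by simp [lateFn]

theorem headFn_eq_true {B K l : ℕ} {U : Finset (ℕ × ℕ)} {b : ℕ} :
    headFn B K l U b = true ↔ HasHead B K l U b := by simp [headFn]

theorem listLate_eq {B K l : ℕ} (hB : 0 < B) (hl : 1 ≤ l) {U : Finset (ℕ × ℕ)}
    {M : List (ℕ × ℕ)} (hnd : M.Nodup) (hM : summary B K l U ⊆ M.toFinset)
    (hMU : M.toFinset ⊆ U) : listLate B K l M = lateFn B K l U := by
  funext b
  rw [Bool.eq_iff_iff, lateFn_eq_true, ← isLate_iff hB hl hM hMU]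
  simp [listLate, IsLate, listRank_eq hnd]

theorem listHead_eq {B K l : ℕ} (hB : 0 < B) (hl : 1 ≤ l) {U : Finset (ℕ × ℕ)}
    {M : List (ℕ × ℕ)} (hnd : M.Nodup) (hM : summary B K l U ⊆ M.toFinset)
    (hMU : M.toFinset ⊆ U) : listHead B K l M = headFn B K l U := by
  funext b
  rw [Bool.eq_iff_iff, headFn_eq_true, ← hasHead_iff hB hl hM hMU]
  simp [listHead, HasHead, listRank_eq hnd]

/-! ### Times at which windows are answered. -/

section Times

variable {B K : ℕ} {late head : ℕ → Bool}

theorem ownTime_le (i : ℕ) : ownTime B K late i ≤ i + K := by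
  unfold ownTime
  split_ifs <;> omega

theorem outTime_mono : Monotone (outTime B K late) :=
  monotone_nat_of_le_succ fun _ => le_max_left _ _

theorem ownTime_le_outTime (i : ℕ) : ownTime B K late i ≤ outTime B K late i := by
  cases i with
  | zero => exact le_rfl
  | succ i => exact le_max_right _ _

theorem exists_outTime_eq (i : ℕ) : ∃ i₀ ≤ i, outTime B K late i = ownTime B K late i₀ := by
  induction i with
  | zero => exact ⟨0, le_rfl, rfl⟩
  | succ i ih =>
    obtain ⟨i₀, h, h'⟩ := ih
    rcases max_choice (outTime B K late i) (ownTime B K late (i + 1)) with hm | hm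
    · exact ⟨i₀, by omega, hm.trans h'⟩
    · exact ⟨i + 1, le_rfl, hm⟩

theorem outTime_le (i : ℕ) : outTime B K late i ≤ i + K := by
  obtain ⟨i₀, h, h'⟩ := exists_outTime_eq (B := B) (K := K) (late := late) i
  have := ownTime_le (B := B) (K := K) (late := late) i₀
  omega

theorem one_le_ownTime (hB : 0 < B) (hK : 0 < K) (i : ℕ) : 1 ≤ ownTime B K late i := by
  unfold ownTime
  split_ifs <;> omega

theorem ownTime_of_late {i : ℕ} (h : late (i / B) = true) : ownTime B K late i = i + K := by
  simp [ownTime, h]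

theorem ownTime_of_not_late {i : ℕ} (h : ¬ late (i / B) = true) :
    ownTime B K late i = i + min (2 * B) K := by
  simp [ownTime, h]

end Times

/-- A delay can only come from a late window `i₀` in an earlier block with `i₀ + K` still ahead. The
block of `i` is then within reach of that block, and `not_hasHead_of_isLate` excludes a head. -/
theorem not_isSecond_of_one {B K : ℕ} (hB : 0 < B) {U : Finset (ℕ × ℕ)} (i : ℕ) :
    ¬ IsSecond B K (lateFn B K 1 U) (headFn B K 1 U) i := by
  rintro ⟨hlate, hhead, hlt⟩
  obtain ⟨i₀, hi₀, h⟩ := exists_outTime_eq (B := B) (K := K) (late := lateFn B K 1 U) i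
  rw [h, ownTime_of_not_late hlate] at hlt
  have hlate₀ : lateFn B K 1 U (i₀ / B) = true := by
    by_contra hcon
    rw [ownTime_of_not_late hcon] at hlt
    omega
  rw [ownTime_of_late hlate₀] at hlt
  have hle : i₀ / B ≤ i / B := Nat.div_le_div_right hi₀
  have hne : i₀ / B ≠ i / B := fun h => hlate (h ▸ hlate₀)
  refine not_hasHead_of_isLate (lt_of_le_of_ne hle hne) ?_ (lateFn_eq_true.1 hlate₀)
    (headFn_eq_true.1 hhead)
  have h₁ := Nat.div_mul_le_self i B
  have h₂ := Nat.lt_div_mul_add (a := i₀) hB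
  rw [add_mul, one_mul]
  omega

/-- Every entry that can be among the `l` first of window `i` is in the summary or held when
the window is answered. -/
theorem mem_summary_or_held {B K l t i : ℕ} (hB : 0 < B) {U : Finset (ℕ × ℕ)}
    (ht : (¬ IsSecond B K (lateFn B K l U) (headFn B K l U) i ∧
        outTime B K (lateFn B K l U) i = t + 1) ∨
      (IsSecond B K (lateFn B K l U) (headFn B K l U) i ∧
        ownTime B K (lateFn B K l U) i = t + 1))
    {e : ℕ × ℕ} (he : e ∈ seg U i (i + K)) (hr : rank (seg U i (i + K)) e < l) :
    e ∈ summary B K l U ∨ (e.1 ≤ t ∧ (t < e.1 + 2 * B ∨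
      (lateFn B K l U (e.1 / B) = true ∧ headFn B K l U (e.1 / B) = true ∧ t < e.1 + K))) := by
  obtain ⟨heU, hie, hei⟩ := mem_seg.1 he
  have h₁ := Nat.div_mul_le_self i B
  have h₂ := Nat.lt_div_mul_add (a := i) hB
  have h₃ : (i / B + 1) * B = i / B * B + B := by ring
  have hmid : rank (seg U ((i / B + 1) * B) (i / B * B + K)) e < l :=
    (rank_mono (seg_subset_seg (by omega) (by omega)) e).trans_lt hr
  have hlate_t : lateFn B K l U (i / B) = true → t + 1 = i + K := fun h => by
    have hown := ownTime_of_late (K := K) h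
    have hout := ownTime_le_outTime (B := B) (K := K) (late := lateFn B K l U) i
    have hout' := outTime_le (B := B) (K := K) (late := lateFn B K l U) i
    omega
  by_cases hlo : e.1 < (i / B + 1) * B
  · right
    have hdiv : e.1 / B = i / B := by
      rw [Nat.div_eq_iff hB]
      omega
    -- An entry of the block among the first `l` of the window is itself a witness for the head
    -- flag; the late flag arises in the same way from an entry behind the middle part.
    have hhead : headFn B K l U (i / B) = true :=
      headFn_eq_true.2 ⟨e, heU, by omega, hlo, hmid⟩
    rw [hdiv]
    by_cases hlate : lateFn B K l U (i / B) = true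
    · have := hlate_t hlate
      exact ⟨by omega, Or.inr ⟨hlate, hhead, by omega⟩⟩
    · have hown := ownTime_of_not_late (K := K) hlate
      have hout := ownTime_le_outTime (B := B) (K := K) (late := lateFn B K l U) i
      have ht' : t + 1 = i + min (2 * B) K := by
        rcases ht with ⟨hs, ht⟩ | ⟨-, ht⟩
        -- A window with a head that is neither late nor put off is not delayed at all.
        · have : ¬ ownTime B K (lateFn B K l U) i < outTime B K (lateFn B K l U) i :=
            fun h => hs ⟨hlate, hhead, h⟩
          omega
        · omega
      exact ⟨by omega, Or.inl (by omega)⟩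
  · by_cases hhi : e.1 < i / B * B + K
    · left
      -- The cell of a middle entry stays inside the middle part, hence inside the window.
      refine mem_filter.2 ⟨heU, lt_of_le_of_lt (rank_mono (fun f hf => ?_) e) hr⟩
      obtain ⟨hfU, hcell⟩ := mem_filter.1 hf
      have h₄ := le_iff_of_cellIdx_eq hB hcell (i / B + 1)
      have h₅ := add_le_iff_of_cellIdx_eq hB hcell (i / B)
      exact mem_seg.2 ⟨hfU, by omega, by omega⟩
    · right
      have hlate : lateFn B K l U (i / B) = true :=
        lateFn_eq_true.2 ⟨e, heU, by omega, by omega, hmid⟩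
      have := hlate_t hlate
      exact ⟨by omega, Or.inl (by omega)⟩

theorem exists_rank_listValue {K l i : ℕ} (hl : 1 ≤ l) {U : Finset (ℕ × ℕ)} {M : List (ℕ × ℕ)}
    (hnd : M.Nodup) (hMU : M.toFinset ⊆ U)
    (hM : {f ∈ seg U i (i + K) | rank (seg U i (i + K)) f < l} ⊆ M.toFinset)
    (hcard : l ≤ #(seg U i (i + K))) :
    ∃ e ∈ seg U i (i + K), rank (seg U i (i + K)) e + 1 = l ∧ listValue l K M i = e.2 := by
  set S := seg U i (i + K) with hS
  set T := seg M.toFinset i (i + K) with hT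
  have hTS : T ⊆ S := filter_subset_filter _ hMU
  have hsub : {f ∈ S | rank S f < l} ⊆ T := fun f hf =>
    mem_seg.2 ⟨hM hf, (mem_seg.1 (mem_filter.1 hf).1).2⟩
  set F := M.filter fun e =>
    decide ((i ≤ e.1 ∧ e.1 < i + K) ∧ listRank i (i + K) M e + 1 = l) with hF
  have hmem : ∀ e, e ∈ F ↔ e ∈ T ∧ rank T e + 1 = l := fun e => by
    rw [hF, List.mem_filter, decide_eq_true_iff, listRank_eq hnd, hT, mem_seg,
      List.mem_toFinset, and_assoc, and_assoc, and_assoc]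
  -- Ensures that `headI` in `listValue` is a genuine entry and not the default.
  have hne : F ≠ [] := by
    obtain ⟨e, heS, he⟩ := exists_rank_add_one_eq hl hcard
    have heT : e ∈ T := hsub (mem_filter.2 ⟨heS, by omega⟩)
    refine List.ne_nil_of_mem ((hmem e).2 ⟨heT, ?_⟩)
    rw [rank_eq_of_rank_lt hTS hsub (by omega), he]
  obtain ⟨e, F', hcons⟩ := List.exists_cons_of_ne_nil hne
  have heF := (hmem e).1 (by rw [hcons]; exact List.mem_cons_self)
  have hlt : rank S e < l := (rank_lt_iff hTS hsub e).1 (by omega)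
  refine ⟨e, hTS heF.1, ?_, ?_⟩
  · rw [← rank_eq_of_rank_lt hTS hsub hlt, heF.2]
  · rw [listValue, ← hF, hcons, List.headI_cons]

/-! ### The memory invariant and correctness of one step. -/

/-- The first `n` entries of the array `a`. -/
def graph (a : ℕ → ℕ) (n : ℕ) : Finset (ℕ × ℕ) := (range n).image fun j => (j, a j)

theorem mem_graph {a : ℕ → ℕ} {n : ℕ} {e : ℕ × ℕ} : e ∈ graph a n ↔ e.1 < n ∧ e.2 = a e.1 := by
  simp only [graph, mem_image, mem_range]
  constructor
  · rintro ⟨j, hj, rfl⟩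
    exact ⟨hj, rfl⟩
  · rintro ⟨h, h'⟩
    exact ⟨e.1, h, by rw [← h']⟩

theorem card_le_of_fst_mem {a : ℕ → ℕ} {n : ℕ} {T : Finset (ℕ × ℕ)} (hT : T ⊆ graph a n)
    {s : Finset ℕ} (hs : ∀ e ∈ T, e.1 ∈ s) : #T ≤ #s := by
  refine card_le_card_of_injOn Prod.fst hs fun e he f hf h => ?_
  have he' := (mem_graph.1 (hT he)).2
  have hf' := (mem_graph.1 (hT hf)).2
  exact Prod.ext h (by rw [he', hf', h])

/-- The entries in memory after `n` elements of the passes over `a` have been read. -/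
noncomputable def known (B K l N : ℕ) (a : ℕ → ℕ) (n : ℕ) : Finset (ℕ × ℕ) :=
  {e ∈ graph a (min n N) |
    rank {f ∈ graph a (min n N) | cellIdx B K f.1 = cellIdx B K e.1} e < l ∨
    Holds B K (lateFn B K l (graph a (min n N))) (headFn B K l (graph a (min n N)))
      (min (n / N) 3) (n % N) e}

theorem summary_subset_known (B K l N : ℕ) (a : ℕ → ℕ) (n : ℕ) :
    summary B K l (graph a (min n N)) ⊆ known B K l N a n :=
  monotone_filter_right _ fun _ _ h => Or.inl h

theorem clock_succ {N n : ℕ} (hN : 0 < N) :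
    (n % N + 1 < N ∧ (n + 1) / N = n / N ∧ (n + 1) % N = n % N + 1) ∨
      (n % N + 1 = N ∧ (n + 1) / N = n / N + 1 ∧ (n + 1) % N = 0) := by
  have h := Nat.div_add_mod n N
  have hlt := Nat.mod_lt n hN
  rcases Nat.lt_or_ge (n % N + 1) N with h' | h'
  · left
    have : n + 1 = (n % N + 1) + N * (n / N) := by omega
    refine ⟨h', ?_, ?_⟩
    · rw [this, Nat.add_mul_div_left _ _ hN, Nat.div_eq_of_lt h', zero_add]
    · rw [this, Nat.add_mul_mod_self_left, Nat.mod_eq_of_lt h']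
  · right
    have h₀ : n % N + 1 = N := by omega
    have : n + 1 = N * (n / N + 1) := by rw [mul_add, mul_one]; omega
    refine ⟨h₀, ?_, ?_⟩
    · rw [this, Nat.mul_div_cancel_left _ hN]
    · rw [this, Nat.mul_mod_right]

theorem tick_clock {N n : ℕ} (hN : 0 < N) :
    tick N (min (n / N) 3, n % N) = (min ((n + 1) / N) 3, (n + 1) % N) := by
  unfold tick
  rcases clock_succ (n := n) hN with ⟨h₁, h₂, h₃⟩ | ⟨h₁, h₂, h₃⟩
  · rw [if_pos h₁, h₂, h₃]
  · rw [if_neg (by simp [h₁]), h₂, h₃]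
    exact Prod.ext (by simp only; omega) rfl

theorem mem_addEntry {e f : ℕ × ℕ} {M : List (ℕ × ℕ)} :
    f ∈ addEntry e M ↔ f = e ∨ f ∈ M := by
  unfold addEntry
  split_ifs with h
  · constructor
    · exact Or.inr
    · rintro (rfl | h')
      · obtain ⟨g, hg, rfl⟩ := h
        exact hg
      · exact h'
  · exact List.mem_cons

theorem nodup_addEntry {e : ℕ × ℕ} {M : List (ℕ × ℕ)} (hM : M.Nodup) :
    (addEntry e M).Nodup := by
  unfold addEntry
  split_ifs with h
  · exact hM
  · exact List.nodup_cons.2 ⟨fun he => h ⟨e, he, rfl⟩, hM⟩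

section Step

variable {B K l N : ℕ} {a : ℕ → ℕ} {n : ℕ} {M : List (ℕ × ℕ)}

theorem addEntry_subset_graph (hN : 0 < N) (hM : M.toFinset = known B K l N a n) :
    (addEntry (n % N, a (n % N)) M).toFinset ⊆ graph a (min (n + 1) N) := by
  intro e he
  rw [List.mem_toFinset, mem_addEntry] at he
  have h₁ := Nat.mod_lt n hN
  have h₂ := Nat.mod_le n N
  rcases he with rfl | he
  · exact mem_graph.2 ⟨by simp only; omega, rfl⟩
  · rw [← List.mem_toFinset, hM] at he
    have := mem_graph.1 (mem_filter.1 he).1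
    exact mem_graph.2 ⟨by omega, this.2⟩

/-- Reading more entries only raises ranks within a cell, so an entry of the new summary was in the
old one or has just been read. -/
theorem summary_subset_addEntry (hM : M.toFinset = known B K l N a n) :
    summary B K l (graph a (min (n + 1) N)) ⊆ (addEntry (n % N, a (n % N)) M).toFinset := by
  intro e he
  rw [List.mem_toFinset, mem_addEntry, ← List.mem_toFinset, hM]
  obtain ⟨heU, her⟩ := mem_filter.1 he
  have hg := mem_graph.1 heU
  rcases Nat.lt_or_ge n N with hn | hn
  · rw [Nat.mod_eq_of_lt hn]
    by_cases hen : e.1 = n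
    · left
      exact Prod.ext hen (by rw [hg.2, hen])
    · right
      refine summary_subset_known B K l N a n (mem_filter.2
        ⟨mem_graph.2 ⟨by omega, hg.2⟩, lt_of_le_of_lt (rank_mono ?_ e) her⟩)
      refine filter_subset_filter _ fun f hf => ?_
      have := mem_graph.1 hf
      exact mem_graph.2 ⟨by omega, this.2⟩
  · right
    have h₁ : min (n + 1) N = min n N := by omega
    rw [h₁] at he
    exact summary_subset_known B K l N a n he

theorem toFinset_listKeep (hB : 0 < B) (hl : 1 ≤ l) (hN : 0 < N) (hnd : M.Nodup)
    (hM : M.toFinset = known B K l N a n) :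
    (listKeep B K l (tick N (min (n / N) 3, n % N))
      (addEntry (n % N, a (n % N)) M)).toFinset = known B K l N a (n + 1) := by
  have hsub := addEntry_subset_graph hN hM
  have hsum := summary_subset_addEntry hM
  have hnd' := nodup_addEntry (e := (n % N, a (n % N))) hnd
  rw [listKeep, tick_clock hN, listLate_eq hB hl hnd' hsum hsub,
    listHead_eq hB hl hnd' hsum hsub]
  ext e
  rw [List.mem_toFinset, List.mem_filter, decide_eq_true_iff, listCellRank_eq hnd', known,
    mem_filter, rank_cell_lt_iff hsum hsub, ← List.mem_toFinset]
  refine ⟨fun h => ⟨hsub h.1, h.2⟩, fun h => ⟨?_, h.2⟩⟩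
  rcases h.2 with h' | h'
  · exact hsum (mem_filter.2 ⟨h.1, h'⟩)
  -- Holding requires `1 ≤ q`, so within a pass the array is already complete and the flags are
  -- final. An entry held now was held one step earlier unless it has just been read. At the start
  -- of a pass the position is 0 and nothing is held.
  · obtain ⟨hq, het, hhold⟩ := h'
    rw [List.mem_toFinset, mem_addEntry, ← List.mem_toFinset, hM]
    rcases clock_succ (n := n) hN with ⟨h₁, h₂, h₃⟩ | ⟨h₁, h₂, h₃⟩
    · rw [h₃] at het hhold
      rw [h₂] at hq
      have hqn : 1 ≤ n / N := by omega
      have hn : N ≤ n := by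
        by_contra hcon
        rw [Nat.div_eq_of_lt (by omega)] at hqn
        omega
      have hmin : min (n + 1) N = min n N := by omega
      have hg := mem_graph.1 h.1
      by_cases hen : e.1 = n % N
      · left
        exact Prod.ext hen (by rw [hg.2, hen])
      · right
        rw [hmin] at h hhold
        refine mem_filter.2 ⟨h.1, Or.inr ⟨hq, by omega, ?_⟩⟩
        rcases hhold with hh | ⟨hh₁, hh₂, hh₃⟩
        · exact Or.inl (by omega)
        · exact Or.inr ⟨hh₁, hh₂, by omega⟩
    · omega

theorem card_seg_graph {i : ℕ} (hi : i + K ≤ N) : #(seg (graph a N) i (i + K)) = K := by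
  have : seg (graph a N) i (i + K) = (Ico i (i + K)).image fun j => (j, a j) := by
    ext e
    simp only [mem_seg, mem_graph, mem_image, mem_Ico]
    constructor
    · rintro ⟨⟨-, h⟩, h'⟩
      exact ⟨e.1, h', by rw [← h]⟩
    · rintro ⟨j, hj, rfl⟩
      exact ⟨⟨by simp only; omega, rfl⟩, hj⟩
  rw [this, card_image_of_injective _ fun x y h => (Prod.mk.inj h).1, Nat.card_Ico]
  omega

/-- Pass 0 writes nothing. From pass 1 on the flags are those of the complete array, and
`mem_summary_or_held` supplies every entry that the answer depends on. -/
theorem listEmit_spec (hB : 0 < B) (hl : 1 ≤ l) (hlK : l ≤ K) (hKN : K ≤ N) (hnd : M.Nodup)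
    (hM : M.toFinset = known B K l N a n) :
    (listEmit l N K B (min (n / N) 3, n % N) (addEntry (n % N, a (n % N)) M)).map Prod.fst =
        ((List.range (N - K + 1)).filter fun i => decide (Emits B K (lateFn B K l (graph a N))
          (headFn B K l (graph a N)) (min (n / N) 3) (n % N) i)) ∧
      ∀ e ∈ listEmit l N K B (min (n / N) 3, n % N) (addEntry (n % N, a (n % N)) M),
        e.1 + K ≤ N ∧ ∃ e' ∈ seg (graph a N) e.1 (e.1 + K),
          rank (seg (graph a N) e.1 (e.1 + K)) e' + 1 = l ∧ e.2 = e'.2 := by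
  have hN : 0 < N := by omega
  rw [listEmit, List.map_map]
  have hfst : (Prod.fst ∘ fun i =>
      (i, listValue l K (addEntry (n % N, a (n % N)) M) i)) = id := rfl
  rw [hfst, List.map_id]
  rcases Nat.lt_or_ge n N with hn | hn
  · have hE : ∀ late head i, ¬ Emits B K late head (min (n / N) 3) (n % N) i := by
      intro late head i
      rw [Nat.div_eq_of_lt hn]
      rintro (⟨h, -⟩ | ⟨h, -⟩) <;> simp at h
    simp [hE]
  · have hmin : min (n + 1) N = N := by omega
    have hmin' : min n N = N := by omega
    have hsub := addEntry_subset_graph hN hM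
    have hsum := summary_subset_addEntry hM
    have hnd' := nodup_addEntry (e := (n % N, a (n % N))) hnd
    rw [hmin] at hsub hsum
    rw [listLate_eq hB hl hnd' hsum hsub, listHead_eq hB hl hnd' hsum hsub]
    refine ⟨rfl, fun e he => ?_⟩
    obtain ⟨i, hi, rfl⟩ := List.mem_map.1 he
    rw [List.mem_filter, List.mem_range, decide_eq_true_iff] at hi
    obtain ⟨hi, hemit⟩ := hi
    have hiK : i + K ≤ N := by omega
    refine ⟨hiK, ?_⟩
    have hlow : {f ∈ seg (graph a N) i (i + K) | rank (seg (graph a N) i (i + K)) f < l} ⊆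
        (addEntry (n % N, a (n % N)) M).toFinset := by
      intro f hf
      obtain ⟨hf₁, hf₂⟩ := mem_filter.1 hf
      have hheld := mem_summary_or_held (t := n % N) hB
        (hemit.imp (fun h => h.2) (fun h => h.2)) hf₁ hf₂
      rcases hheld with hs | ⟨ht, hheld⟩
      · exact hsum hs
      · have hfU := (mem_seg.1 hf₁).1
        rw [List.mem_toFinset, mem_addEntry, ← List.mem_toFinset, hM]
        have hg := mem_graph.1 hfU
        by_cases hft : f.1 = n % N
        · left
          exact Prod.ext hft (by rw [hg.2, hft])
        · right
          have hq : 1 ≤ n / N := (Nat.one_le_div_iff hN).2 hn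
          rw [known, hmin']
          refine mem_filter.2 ⟨hfU, Or.inr ⟨by omega, by omega, hheld⟩⟩
    exact exists_rank_listValue hl hnd' hsub hlow (by rw [card_seg_graph hiK]; exact hlK)

end Step

/-! ### The number of entries in memory. -/

/-- Compare all blocks with the earliest one, `c`. Those within reach of `c` are counted by
`card_crossing_le`; the others end beyond `c * B + K` but start before `(c + 1) * B + K`, which
leaves two candidates. -/
theorem card_held_blocks_le {B K l t : ℕ} (hB : 0 < B) {U : Finset (ℕ × ℕ)}
    {S : Finset ℕ} (hS : ∀ b ∈ S, IsLate B K l U b ∧ HasHead B K l U b)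
    (ht : ∀ b ∈ S, b * B < t ∧ t < (b + 1) * B + K) : #S ≤ l + 2 := by
  rcases S.eq_empty_or_nonempty with rfl | hne
  · simp
  set c := S.min' hne with hc
  have hcS : c ∈ S := S.min'_mem hne
  set d := (c * B + K) / B with hd
  have h₁ : #{b ∈ S | (b + 1) * B ≤ c * B + K} ≤ l :=
    card_crossing_le (c := c) (fun b hb => hS b (mem_filter.1 hb).1) fun b hb =>
      ⟨S.min'_le b (mem_filter.1 hb).1, (mem_filter.1 hb).2⟩
  have h₂ : #{b ∈ S | ¬ (b + 1) * B ≤ c * B + K} ≤ 2 := by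
    refine (card_le_card (t := {d, d + 1}) fun b hb => ?_).trans card_le_two
    obtain ⟨hbS, hb⟩ := mem_filter.1 hb
    have k₁ : d < b + 1 := (Nat.div_lt_iff_lt_mul hB).2 (by omega)
    have k₂ : b < d + 2 := by
      have := (ht b hbS).1
      have h₃ := (ht c hcS).2
      have h₄ := Nat.lt_div_mul_add (a := c * B + K) hB
      rw [← hd] at h₄
      have h₅ : (c + 1) * B = c * B + B := by ring
      have h₆ : (d + 2) * B = d * B + 2 * B := by ring
      exact Nat.lt_of_mul_lt_mul_right (a := B) (by omega)
    rw [mem_insert, mem_singleton]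
    omega
  have := card_filter_add_card_filter_not (s := S) (fun b => (b + 1) * B ≤ c * B + K)
  omega

theorem cellIdx_lt {B K N j : ℕ} (hB : 0 < B) (hN : N / B ≤ B - 1) (hj : j < N) :
    cellIdx B K j < 2 * B := by
  unfold cellIdx
  have h₁ : j / B ≤ N / B := Nat.div_le_div_right hj.le
  have h₂ : (j + (B - K % B)) / B ≤ (N + B) / B := Nat.div_le_div_right (by omega)
  rw [Nat.add_div_right _ hB] at h₂
  omega

/-- The summary has at most `2 * l * B` entries, the recent ones number at most `2 * B`, and the
held blocks contain at most `(l + 2) * B`; with `1 ≤ l` the sum is at most `7 * l * B`. -/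
theorem card_known_le {B K l N : ℕ} (hB : 0 < B) (hl : 1 ≤ l) (hN : N / B ≤ B - 1)
    (a : ℕ → ℕ) (n : ℕ) : #(known B K l N a n) ≤ 7 * (l * B) := by
  set U := graph a (min n N) with hU
  have hUN : ∀ e ∈ U, e.1 < N := fun e he => by
    have := (mem_graph.1 he).1
    omega
  set t := n % N with ht
  set T : Finset (ℕ × ℕ) := {e ∈ U | e.1 < t ∧ t < e.1 + 2 * B} with hT
  set V : Finset (ℕ × ℕ) := {e ∈ U | e.1 < t ∧ lateFn B K l U (e.1 / B) = true ∧
    headFn B K l U (e.1 / B) = true ∧ t < e.1 + K} with hV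
  have hsub : known B K l N a n ⊆ summary B K l U ∪ (T ∪ V) := by
    intro e he
    obtain ⟨he, h⟩ := mem_filter.1 he
    rw [mem_union, mem_union]
    rcases h with h | ⟨-, h₁, h | h⟩
    · exact Or.inl (mem_filter.2 ⟨he, h⟩)
    · exact Or.inr (Or.inl (mem_filter.2 ⟨he, h₁, h⟩))
    · exact Or.inr (Or.inr (mem_filter.2 ⟨he, h₁, h⟩))
  have h₁ : #(summary B K l U) ≤ l * (2 * B) :=
    card_summary_le fun e he => cellIdx_lt hB hN (hUN e he)
  have h₂ : #T ≤ 2 * B := by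
    refine (card_le_of_fst_mem (s := Ico (t - 2 * B) t) (filter_subset _ _) fun e he => ?_).trans ?_
    · have := (mem_filter.1 he).2
      rw [mem_Ico]
      omega
    · rw [Nat.card_Ico]
      omega
  have h₃ : #V ≤ B * (l + 2) := by
    have hblock : #(V.image fun e => e.1 / B) ≤ l + 2 := by
      refine card_held_blocks_le (B := B) (K := K) (t := t) (U := U) hB ?_ ?_
      · intro b hb
        obtain ⟨e, he, rfl⟩ := mem_image.1 hb
        have := (mem_filter.1 he).2
        exact ⟨lateFn_eq_true.1 this.2.1, headFn_eq_true.1 this.2.2.1⟩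
      · intro b hb
        obtain ⟨e, he, rfl⟩ := mem_image.1 hb
        have := (mem_filter.1 he).2
        have k₁ := Nat.div_mul_le_self e.1 B
        have k₂ := Nat.lt_div_mul_add (a := e.1) hB
        have k₃ : (e.1 / B + 1) * B = e.1 / B * B + B := by ring
        omega
    refine (card_le_mul_card_image (f := fun e => e.1 / B) V B fun b _ => ?_).trans
      (Nat.mul_le_mul_left B hblock)
    refine (card_le_of_fst_mem (s := Ico (b * B) (b * B + B))
      ((filter_subset _ _).trans (filter_subset _ _)) fun e he => ?_).trans ?_
    · have k : e.1 / B = b := (mem_filter.1 he).2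
      subst k
      have k₁ := Nat.div_mul_le_self e.1 B
      have k₂ := Nat.lt_div_mul_add (a := e.1) hB
      rw [mem_Ico]
      omega
    · rw [Nat.card_Ico]
      omega
  have h₄ := (card_le_card hsub).trans ((card_union_le _ _).trans
    (Nat.add_le_add_left (card_union_le _ _) _))
  have h₅ : B ≤ l * B := Nat.le_mul_of_pos_left B hl
  have h₆ : l * (2 * B) = 2 * (l * B) := by ring
  have h₇ : B * (l + 2) = l * B + 2 * B := by ring
  omega

/-! ### Running the algorithm over all passes. -/

section Stream

variable {P : Type} [Primcodable P]

theorem memoryFrom_append (S : StreamAlg P) (p : P) (m : List Bool) (xs ys : List ℕ) :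
    S.memoryFrom p m (xs ++ ys) = S.memoryFrom p (S.memoryFrom p m xs) ys := by
  induction xs generalizing m with
  | nil => rfl
  | cons x xs ih => exact ih _

theorem outputFrom_append (S : StreamAlg P) (p : P) (m : List Bool) (xs ys : List ℕ) :
    S.outputFrom p m (xs ++ ys) =
      S.outputFrom p m xs ++ S.outputFrom p (S.memoryFrom p m xs) ys := by
  induction xs generalizing m with
  | nil => rfl
  | cons x xs ih =>
    simp only [List.cons_append, StreamAlg.outputFrom, StreamAlg.memoryFrom, ih,
      List.append_assoc]

end Stream

/-- The array as a function on all positions. -/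
def extend {N : ℕ} (A : Fin N → ℕ) (j : ℕ) : ℕ := if h : j < N then A ⟨j, h⟩ else 0

theorem extend_le {N R : ℕ} {A : Fin N → ℕ} (hA : ∀ j, A j ≤ R) (j : ℕ) : extend A j ≤ R := by
  unfold extend
  split_ifs
  · exact hA _
  · exact Nat.zero_le _

theorem passes_eq {N : ℕ} (q : ℕ) (A : Fin N → ℕ) :
    StreamAlg.passes q A = (List.range (q * N)).map fun n => extend A (n % N) := by
  induction q with
  | zero => simp [StreamAlg.passes]
  | succ q ih =>
    have h : StreamAlg.passes (q + 1) A = StreamAlg.passes q A ++ List.ofFn A := by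
      simp [StreamAlg.passes, List.replicate_succ']
    rw [h, ih, add_mul, one_mul, List.range_add, List.map_append, List.map_map]
    congr 1
    refine List.ext_getElem (by simp) fun k h₁ h₂ => ?_
    have hk : k < N := by simpa using h₁
    simp [extend, Nat.mod_eq_of_lt hk, hk]

theorem isLthSmallest_of_rank {N K l i : ℕ} {A : Fin N → ℕ} {e : ℕ × ℕ}
    (he : e ∈ seg (graph (extend A) N) i (i + K))
    (hr : rank (seg (graph (extend A) N) i (i + K)) e + 1 = l) :
    IsLthSmallest A K l i e.2 := by
  obtain ⟨heU, hi, hiK⟩ := mem_seg.1 he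
  obtain ⟨heN, he₂⟩ := mem_graph.1 heU
  have hAe : A ⟨e.1, heN⟩ = e.2 := by rw [he₂, extend, dif_pos heN]
  refine ⟨⟨e.1, heN⟩, hi, hiK, ?_, hAe⟩
  have hinj : Function.Injective fun j : Fin N => ((j : ℕ), A j) := fun x y h =>
    Fin.ext (Prod.mk.inj h).1
  -- `windowRank` counts the entry itself and `rank` does not; inserting `e` accounts for the
  -- difference.
  rw [windowRank, ← card_image_of_injective _ hinj, ← hr, rank,
    ← card_insert_of_notMem (a := e) (by simp [not_precedes_self]), hAe]
  congr 1
  ext f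
  simp only [mem_image, mem_filter, mem_univ, true_and, mem_insert, mem_seg, mem_graph]
  constructor
  · rintro ⟨j, ⟨h₁, h₂, h₃⟩, rfl⟩
    have hj : A j = extend A j := by rw [extend, dif_pos j.2]
    by_cases hje : (j : ℕ) = e.1
    · left
      refine Prod.ext hje ?_
      rw [he₂, ← hje]
      exact hj
    · right
      refine ⟨⟨⟨j.2, hj⟩, h₁, h₂⟩, ?_⟩
      rcases h₃ with h₃ | ⟨h₃, h₄⟩
      · exact Or.inl h₃
      · have h₄ : (j : ℕ) ≤ e.1 := h₄
        exact Or.inr ⟨h₃, by simp only; omega⟩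
  · rintro (rfl | ⟨⟨⟨h₁, h₂⟩, h₃, h₄⟩, h₅⟩)
    · exact ⟨⟨f.1, heN⟩, ⟨hi, hiK, Or.inr ⟨hAe, le_rfl⟩⟩, by simp [hAe]⟩
    · have hAf : A ⟨f.1, h₁⟩ = f.2 := by rw [h₂, extend, dif_pos h₁]
      refine ⟨⟨f.1, h₁⟩, ⟨h₃, h₄, ?_⟩, by simp [hAf]⟩
      rw [hAf]
      rcases h₅ with h₅ | ⟨h₅, h₆⟩
      · exact Or.inl h₅
      · exact Or.inr ⟨h₅, h₆.le⟩

/-- The memory holds the clock and the entries `known` after `n` elements have been read. -/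
def Inv (l N K R : ℕ) (a : ℕ → ℕ) (n : ℕ) (m : List Bool) : Prop :=
  ∃ M : List (ℕ × ℕ), m = pack (width N R) ((min (n / N) 3, n % N) :: M) ∧ M.Nodup ∧
    M.toFinset = known (blockLength N) K l N a n

/-- The windows answered at clock `(q, t)`. -/
noncomputable def answered (l N K : ℕ) (a : ℕ → ℕ) (q t : ℕ) : List ℕ :=
  (List.range (N - K + 1)).filter fun i => decide (Emits (blockLength N) K
    (lateFn (blockLength N) K l (graph a N)) (headFn (blockLength N) K l (graph a N)) q t i)

/-- A written entry `(i, v)` is correct. -/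
def Correct (l N K : ℕ) (a : ℕ → ℕ) (e : ℕ × ℕ) : Prop :=
  e.1 + K ≤ N ∧ ∃ e' ∈ seg (graph a N) e.1 (e.1 + K),
    rank (seg (graph a N) e.1 (e.1 + K)) e' + 1 = l ∧ e.2 = e'.2

theorem lt_two_pow_width (N R : ℕ) : N + R + 4 < 2 ^ width N R :=
  Nat.lt_pow_succ_log_self (by norm_num) _

section Run

variable {l N K R : ℕ} {a : ℕ → ℕ}

theorem inv_step (hl : 1 ≤ l) (hlK : l ≤ K) (hKN : K ≤ N) (ha : ∀ j, a j ≤ R) {n : ℕ}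
    {m : List Bool} (hm : Inv l N K R a n m) :
    Inv l N K R a (n + 1) (alg.step (l, N, K, R) m (a (n % N))).1 ∧
      (alg.step (l, N, K, R) m (a (n % N))).2.map Prod.fst =
        answered l N K a (min (n / N) 3) (n % N) ∧
      ∀ e ∈ (alg.step (l, N, K, R) m (a (n % N))).2, Correct l N K a e := by
  obtain ⟨M, rfl, hnd, hM⟩ := hm
  have hN : 0 < N := by omega
  have hB : 0 < blockLength N := Nat.succ_pos _
  -- The width must cover positions, values and the pass counter, which is at most 3.
  have hw := lt_two_pow_width N R
  have hunpack : unpack (width N R) (pack (width N R) ((min (n / N) 3, n % N) :: M)) =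
      (min (n / N) 3, n % N) :: M := by
    refine unpack_pack (show 0 < width N R from Nat.succ_pos _) fun e he => ?_
    rcases List.mem_cons.1 he with rfl | he
    · have := Nat.mod_lt n hN
      constructor <;> simp only <;> omega
    · rw [← List.mem_toFinset, hM] at he
      obtain ⟨h₁, h₂⟩ := mem_graph.1 (mem_filter.1 he).1
      have := ha e.1
      omega
  have hstep : alg.step (l, N, K, R)
      (pack (width N R) ((min (n / N) 3, n % N) :: M)) (a (n % N)) =
      (pack (width N R) (tick N (min (n / N) 3, n % N) ::
        listKeep (blockLength N) K l (tick N (min (n / N) 3, n % N))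
          (addEntry (n % N, a (n % N)) M)),
        listEmit l N K (blockLength N) (min (n / N) 3, n % N)
          (addEntry (n % N, a (n % N)) M)) := by
    simp only [alg, hunpack, listStep, List.headI_cons, List.tail_cons]
  rw [hstep]
  refine ⟨⟨_, ?_, ?_, toFinset_listKeep hB hl hN hnd hM⟩,
    listEmit_spec hB hl hlK hKN hnd hM⟩
  · rw [tick_clock hN]
  · exact (nodup_addEntry hnd).filter _

theorem inv_zero : Inv l N K R a 0 (alg.init (l, N, K, R)) := by
  refine ⟨[], ?_, List.nodup_nil, ?_⟩
  · simp [alg]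
  · simp [known, graph]

theorem run_spec (hl : 1 ≤ l) (hlK : l ≤ K) (hKN : K ≤ N) (ha : ∀ j, a j ≤ R) (n : ℕ) :
    Inv l N K R a n (alg.memoryFrom (l, N, K, R) (alg.init (l, N, K, R))
        ((List.range n).map fun n => a (n % N))) ∧
      (alg.outputFrom (l, N, K, R) (alg.init (l, N, K, R))
        ((List.range n).map fun n => a (n % N))).map Prod.fst =
          (List.range n).flatMap (fun n => answered l N K a (min (n / N) 3) (n % N)) ∧
      ∀ e ∈ alg.outputFrom (l, N, K, R) (alg.init (l, N, K, R))
        ((List.range n).map fun n => a (n % N)), Correct l N K a e := by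
  induction n with
  | zero => exact ⟨inv_zero, rfl, fun e he => absurd he List.not_mem_nil⟩
  | succ n ih =>
    obtain ⟨h₁, h₂, h₃⟩ := ih
    obtain ⟨k₁, k₂, k₃⟩ := inv_step hl hlK hKN ha h₁
    rw [List.range_succ, List.map_append, memoryFrom_append, outputFrom_append,
      List.map_append, h₂, List.flatMap_append]
    refine ⟨k₁, ?_, fun e he => ?_⟩
    · congr 1
      simpa [StreamAlg.outputFrom] using k₂
    · rcases List.mem_append.1 he with he | he
      · exact h₃ e he
      · exact k₃ e (by simpa [StreamAlg.outputFrom] using he)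

/-! ### Order and completeness of the output. -/

/-- The windows answered in pass `q`. -/
noncomputable def answeredIn (l N K : ℕ) (a : ℕ → ℕ) (q : ℕ) : List ℕ :=
  (List.range N).flatMap (answered l N K a q)

theorem flatMap_answered (hN : 0 < N) (q : ℕ) :
    (List.range (q * N)).flatMap (fun n => answered l N K a (min (n / N) 3) (n % N)) =
      (List.range q).flatMap fun q => answeredIn l N K a (min q 3) := by
  induction q with
  | zero => simp
  | succ q ih =>
    rw [add_mul, one_mul, List.range_add, List.flatMap_append, ih, List.range_succ,
      List.flatMap_append, List.flatMap_singleton, List.flatMap_map]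
    congr 1
    refine List.flatMap_congr fun t ht => ?_
    have ht := List.mem_range.1 ht
    have h₁ : (q * N + t) / N = q := by
      rw [mul_comm, Nat.mul_add_div hN, Nat.div_eq_of_lt ht, add_zero]
    have h₂ : (q * N + t) % N = t := by
      rw [mul_comm, Nat.mul_add_mod, Nat.mod_eq_of_lt ht]
    rw [h₁, h₂]

theorem answeredIn_eq_nil {q : ℕ} (h₁ : q ≠ 1) (h₂ : q ≠ 2) : answeredIn l N K a q = [] := by
  refine List.flatMap_eq_nil_iff.2 fun t _ => List.filter_eq_nil_iff.2 fun i _ => ?_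
  rw [decide_eq_true_iff]
  rintro (⟨h, -⟩ | ⟨h, -⟩)
  · exact h₁ h
  · exact h₂ h

theorem mem_answeredIn {q i : ℕ} : i ∈ answeredIn l N K a q ↔ i < N - K + 1 ∧ ∃ t < N,
    Emits (blockLength N) K (lateFn (blockLength N) K l (graph a N))
      (headFn (blockLength N) K l (graph a N)) q t i := by
  simp only [answeredIn, answered, List.mem_flatMap, List.mem_range, List.mem_filter,
    decide_eq_true_iff]
  constructor
  · rintro ⟨t, ht, hi, h⟩
    exact ⟨hi, t, ht, h⟩
  · rintro ⟨hi, t, ht, h⟩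
    exact ⟨t, ht, hi, h⟩

theorem answeredIn_two_of_one : answeredIn 1 N K a 2 = [] := by
  refine List.eq_nil_iff_forall_not_mem.2 fun i hi => ?_
  obtain ⟨-, t, -, h⟩ := mem_answeredIn.1 hi
  rcases h with ⟨h, -⟩ | ⟨-, h, -⟩
  · exact absurd h (by norm_num)
  · exact not_isSecond_of_one (Nat.succ_pos _) i h

/-- In pass 1 the answer times are monotone by the running maximum. In pass 2 no window is late, so
its time is its index plus a constant. -/
theorem pairwise_answeredIn (q : ℕ) : (answeredIn l N K a q).Pairwise (· < ·) := by
  refine List.pairwise_flatMap.2 ⟨fun t _ => List.pairwise_lt_range.filter _,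
    List.pairwise_lt_range.imp fun {t₁ t₂} ht i hi j hj => ?_⟩
  rw [answered, List.mem_filter, decide_eq_true_iff] at hi hj
  rcases hi.2 with ⟨hq, hs, hi'⟩ | ⟨hq, hs, hi'⟩ <;>
    rcases hj.2 with ⟨hq', hs', hj'⟩ | ⟨hq', hs', hj'⟩
  · by_contra hle
    have := outTime_mono (B := blockLength N) (K := K)
      (late := lateFn (blockLength N) K l (graph a N)) (not_lt.1 hle)
    omega
  · omega
  · omega
  · rw [ownTime_of_not_late hs.1] at hi'
    rw [ownTime_of_not_late hs'.1] at hj'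
    omega

/-- For `l = 1` there is no pass 2, but nothing would be written in it; for larger `l` the passes
after pass 2 write nothing. -/
theorem output_map_fst (hl : 1 ≤ l) (hlK : l ≤ K) (hKN : K ≤ N) (ha : ∀ j, a j ≤ R) :
    (alg.outputFrom (l, N, K, R) (alg.init (l, N, K, R))
        ((List.range ((l + 1) * N)).map fun n => a (n % N))).map Prod.fst =
      answeredIn l N K a 1 ++ answeredIn l N K a 2 := by
  rw [(run_spec hl hlK hKN ha _).2.1, flatMap_answered (by omega)]
  have h₀ : answeredIn l N K a 0 = [] := answeredIn_eq_nil (by norm_num) (by norm_num)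
  rcases Nat.lt_or_ge l 2 with h | h
  · obtain rfl : l = 1 := by omega
    simp [List.range_succ, h₀, answeredIn_two_of_one]
  · obtain ⟨k, rfl⟩ := Nat.exists_eq_add_of_le h
    have hk : 2 + k + 1 = 3 + k := by omega
    have h₃ : answeredIn (2 + k) N K a 3 = [] := answeredIn_eq_nil (by norm_num) (by norm_num)
    rw [hk, List.range_add, List.flatMap_append, List.flatMap_map]
    simp [List.range_succ, h₀, h₃]

/-- `IsSecond` assigns each window to one pass, and its time lies between 1 and `i + K ≤ N`, so it
does occur in that pass. -/
theorem perm_answeredIn (hl : 1 ≤ l) (hlK : l ≤ K) (hKN : K ≤ N) :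
    (answeredIn l N K a 1 ++ answeredIn l N K a 2).Perm (List.range (N - K + 1)) := by
  have hnd : ∀ q, (answeredIn l N K a q).Nodup := fun q =>
    (pairwise_answeredIn q).imp fun h => h.ne
  have hdisj : (answeredIn l N K a 1).Disjoint (answeredIn l N K a 2) := by
    intro i h₁ h₂
    obtain ⟨-, t₁, -, h₁⟩ := mem_answeredIn.1 h₁
    obtain ⟨-, t₂, -, h₂⟩ := mem_answeredIn.1 h₂
    have h₁' := h₁.resolve_right (by simp)
    have h₂' := h₂.resolve_left (by simp)
    exact h₁'.2.1 h₂'.2.1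
  rw [List.perm_ext_iff_of_nodup ((hnd 1).append (hnd 2) hdisj) List.nodup_range]
  intro i
  rw [List.mem_append, mem_answeredIn, mem_answeredIn, List.mem_range]
  refine ⟨fun h => h.elim And.left And.left, fun hi => ?_⟩
  have h₁ := one_le_ownTime (B := blockLength N) (K := K)
    (late := lateFn (blockLength N) K l (graph a N)) (Nat.succ_pos _) (by omega) i
  have h₂ := ownTime_le_outTime (B := blockLength N) (K := K)
    (late := lateFn (blockLength N) K l (graph a N)) i
  have h₃ := outTime_le (B := blockLength N) (K := K)
    (late := lateFn (blockLength N) K l (graph a N)) i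
  by_cases hs : IsSecond (blockLength N) K (lateFn (blockLength N) K l (graph a N))
      (headFn (blockLength N) K l (graph a N)) i
  · exact Or.inr ⟨hi, ownTime (blockLength N) K (lateFn (blockLength N) K l (graph a N)) i - 1,
      by omega, Or.inr ⟨rfl, hs, by omega⟩⟩
  · exact Or.inl ⟨hi, outTime (blockLength N) K (lateFn (blockLength N) K l (graph a N)) i - 1,
      by omega, Or.inl ⟨rfl, hs, by omega⟩⟩

theorem outputPassesAtMost_of_map_fst (hl : 1 ≤ l) {out : List (ℕ × ℕ)}
    (h : out.map Prod.fst = answeredIn l N K a 1 ++ answeredIn l N K a 2) :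
    OutputPassesAtMost out l := by
  rcases Nat.lt_or_ge l 2 with h' | h'
  · obtain rfl : l = 1 := by omega
    rw [answeredIn_two_of_one, List.append_nil] at h
    refine ⟨[out], by simp, by simp, fun s hs => ?_⟩
    rw [List.mem_singleton.1 hs, h]
    exact pairwise_answeredIn 1
  · obtain ⟨o₁, o₂, rfl, h₁, h₂⟩ := List.map_eq_append_iff.1 h
    refine ⟨[o₁, o₂], by simpa using h', by simp, fun s hs => ?_⟩
    rcases List.mem_cons.1 hs with rfl | hs
    · rw [h₁]
      exact pairwise_answeredIn 1
    · rw [List.mem_singleton.1 hs, h₂]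
      exact pairwise_answeredIn 2

theorem length_le_of_inv (hl : 1 ≤ l) {n : ℕ} {m : List Bool}
    (hm : Inv l N K R a n m) : m.length ≤ 16 * (width N R * (l * blockLength N)) := by
  obtain ⟨M, rfl, hnd, hM⟩ := hm
  have hB : 0 < blockLength N := Nat.succ_pos _
  have hN : N / blockLength N ≤ blockLength N - 1 := by
    have : N / blockLength N < blockLength N :=
      (Nat.div_lt_iff_lt_mul hB).2 (Nat.lt_succ_sqrt N)
    omega
  have hcard := card_known_le (K := K) (N := N) hB hl hN a n
  rw [← hM, List.toFinset_card_of_nodup hnd] at hcard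
  have hpos : 1 ≤ l * blockLength N := Nat.mul_pos hl hB
  rw [length_pack, List.length_cons]
  calc 2 * width N R * (M.length + 1)
      ≤ 2 * width N R * (8 * (l * blockLength N)) := Nat.mul_le_mul_left _ (by omega)
    _ = 16 * (width N R * (l * blockLength N)) := by ring

end Run

/-! ### Real bounds and the conclusion. -/

theorem blockLength_le {N : ℕ} (hN : 1 ≤ N) :
    (blockLength N : ℝ) ≤ 2 * (N : ℝ) ^ (1 / 2 : ℝ) := by
  have h₁ : ((Nat.sqrt N : ℕ) : ℝ) ≤ √N := Real.nat_sqrt_le_real_sqrt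
  have h₂ : 1 ≤ √(N : ℝ) := Real.one_le_sqrt.2 (by exact_mod_cast hN)
  rw [← Real.sqrt_eq_rpow, blockLength]
  push_cast
  linarith

theorem width_le {N R : ℕ} (hN : 1 ≤ N) (hR : 1 ≤ R) (hNR : 2 ≤ N * R) :
    (width N R : ℝ) ≤ 4 / Real.log 2 * (Real.log N + Real.log R) := by
  have hlog2 : 0 < Real.log 2 := Real.log_pos (by norm_num)
  have hN' : (N : ℝ) ≠ 0 := by exact_mod_cast (by omega : N ≠ 0)
  have hR' : (R : ℝ) ≠ 0 := by exact_mod_cast (by omega : R ≠ 0)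
  -- With `P = N * R ≥ 2` the chain is `N + R + 4 ≤ P + 5 ≤ 4 * P ≤ P ^ 3`. The cube costs a factor
  -- 3, and the extra digit in `width` makes it 4.
  have hle : N + R + 4 ≤ (N * R) ^ 3 := by
    have h₁ : N + R ≤ N * R + 1 := by nlinarith
    have h₂ : 4 * (N * R) ≤ (N * R) ^ 3 := by
      rw [pow_succ]
      exact Nat.mul_le_mul_right _ (by nlinarith)
    omega
  have hpow : 2 ^ Nat.log 2 (N + R + 4) ≤ (N * R) ^ 3 :=
    (Nat.pow_log_le_self 2 (by omega)).trans hle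
  have hpow' : ((2 : ℝ) ^ Nat.log 2 (N + R + 4)) ≤ ((N : ℝ) * R) ^ 3 := by exact_mod_cast hpow
  have h₁ := Real.log_le_log (by positivity) hpow'
  rw [Real.log_pow, Real.log_pow, Real.log_mul hN' hR'] at h₁
  have h₂ : Real.log 2 ≤ Real.log N + Real.log R := by
    rw [← Real.log_mul hN' hR']
    exact Real.log_le_log (by norm_num) (by exact_mod_cast hNR)
  rw [div_mul_eq_mul_div, le_div_iff₀ hlog2, width]
  push_cast at h₁ ⊢
  linarith

end SlidingRank

open SlidingRank in
theorem mainTheorem1 :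
    ∃ (alg : StreamAlg (ℕ × ℕ × ℕ × ℕ)) (C : ℝ),
      ∀ l N K R : ℕ, 1 ≤ l → l ≤ K → K ≤ N → 1 ≤ R → 2 ≤ N * R →
        ∀ A : Fin N → ℕ, (∀ j, A j ≤ R) →
          SolvesLSmin A K l (alg.output (l, N, K, R) (l + 1) A) ∧
          OutputPassesAtMost (alg.output (l, N, K, R) (l + 1) A) l ∧
          alg.SpaceAtMost (l, N, K, R) (l + 1) A
            (C * ((l : ℝ) ^ (3 / 2 : ℝ) * (N : ℝ) ^ (1 / 2 : ℝ)
              * (Real.log N + Real.log R))) := by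
  -- The constant is 16 from `length_le_of_inv`, times 4 from `width_le`, times 2 from
  -- `blockLength_le`.
  refine ⟨alg, 128 / Real.log 2, fun l N K R hl hlK hKN hR hNR A hA => ?_⟩
  have ha := extend_le hA
  have hfst := output_map_fst hl hlK hKN ha
  have hrun := run_spec hl hlK hKN ha
  rw [StreamAlg.output, passes_eq]
  refine ⟨⟨?_, fun e he => ?_⟩, outputPassesAtMost_of_map_fst hl hfst, fun xs hxs => ?_⟩
  · rw [hfst]
    exact perm_answeredIn hl hlK hKN
  · obtain ⟨-, e', h₁, h₂, h₃⟩ := (hrun _).2.2 e he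
    rw [h₃]
    exact isLthSmallest_of_rank h₁ h₂
  · rw [passes_eq, List.prefix_iff_eq_take, ← List.map_take, List.take_range] at hxs
    rw [hxs]
    have hlen := length_le_of_inv hl (hrun (min xs.length ((l + 1) * N))).1
    have hlen' := Nat.cast_le (α := ℝ).2 hlen
    refine hlen'.trans ?_
    have hN1 : 1 ≤ N := by omega
    have hw := width_le hN1 hR hNR
    have hB := blockLength_le hN1
    have hl' : (l : ℝ) ≤ (l : ℝ) ^ (3 / 2 : ℝ) := by
      have := Real.rpow_le_rpow_of_exponent_le (x := (l : ℝ)) (by exact_mod_cast hl)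
        (show (1 : ℝ) ≤ 3 / 2 by norm_num)
      rwa [Real.rpow_one] at this
    have hW := (Nat.cast_nonneg (α := ℝ) (width N R)).trans hw
    push_cast
    calc 16 * ((width N R : ℝ) * ((l : ℝ) * (blockLength N : ℝ)))
        ≤ 16 * ((4 / Real.log 2 * (Real.log N + Real.log R)) *
            ((l : ℝ) ^ (3 / 2 : ℝ) * (2 * (N : ℝ) ^ (1 / 2 : ℝ)))) := by gcongr
      _ = 128 / Real.log 2 * ((l : ℝ) ^ (3 / 2 : ℝ) * (N : ℝ) ^ (1 / 2 : ℝ)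
            * (Real.log N + Real.log R)) := by ring
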